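/- Let $q$ be a prime power. For integers $r, R\ge 1$ let the length function $\ell_q(r,R)$ be the smallest length $n$ of an $\mathbb F_q$-linear code $C\subseteq\mathbb F_q^{\,n}$ of codimension $r$ and covering radius $R$, where the covering radius is the least integer $\varrho\ge 0$ such that the Hamming spheres of radius $\varrho$ centred at the codewords cover $\mathbb F_q^{\,n}$. A set $S$ of points of the projective space $\mathrm{PG}(N,q)$ is $\rho$-saturating if every point of $\mathrm{PG}(N,q)$ is (in homogeneous coordinates) a linear combination of at most $\rho+1$ points of $S$, and $\rho\ge 0$ is the smallest integer with this property; let $s_q(N,\rho)$ be the smallest size of a $\rho$-saturating set in $\mathrm{PG}(N,q)$. Let $R\ge 4$ and $t\ge 2$ be integers, put $r=tR$ and $m_1=\lceil\log_q(R+1)\rceil+1$. Then $\ell_q(r,R)=s_q(r-1,R-1)$, and $$\ell_q(r,R)=s_q(r-1,R-1)\le Rq^{(r-R)/R}+q^{(r-2R)/R}+\Delta_q(r,R)$$ holds (in particular such codes and saturating sets exist) in each of the following cases, with the stated value of $\Delta_q(r,R)$; note that $(r-jR)/R=t-j$. (i) $\Delta_q(r,R)=0$ if $t=2$ and $q=4$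 or $q\ge 7$. (ii) $\Delta_q(r,R)=0$ if $t=2$, $q=5$ and $R\in\{4,5\}$. (iii) $\Delta_q(r,R)=0$ if $t\ge\lceil\log_q R\rceil+3$ and $q\ge 7$ is odd. (iv) $\Delta_q(r,R)=\sum_{j=2}^{t}q^{(r-jR)/R}$ if $m_1+2<t<3m_1+2$ and $q\ge 8$ is even. (v) $\Delta_q(r,R)=\sum_{j=2}^{m_1+2}q^{(r-jR)/R}$ if $t=m_1+2$ or $t\ge 3m_1+2$, and $q\ge 8$ is even. -/

import Mathlib

open scoped LinearAlgebra.Projectivization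

/-- Every vector of `K ^ n` lies in a Hamming sphere of radius `ρ` centred at a codeword of the
linear code `C`. -/
def CoversWithRadius {K : Type*} [Field K] [DecidableEq K] {n : ℕ}
    (C : Submodule K (Fin n → K)) (ρ : ℕ) : Prop :=
  ∀ v : Fin n → K, ∃ c ∈ C, hammingDist v c ≤ ρ

/-- `C` is an `[n, n - r]` code over `K` (codimension `r`) whose covering radius is exactly `R`,
that is, `R` is the least radius for which the spheres centred at the codewords cover `K ^ n`. -/
def IsCoveringCode {K : Type*} [Field K] [DecidableEq K] {n : ℕ}
    (C : Submodule K (Fin n → K)) (r R : ℕ) : Prop :=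
  Module.finrank K C + r = n ∧ IsLeast {ρ : ℕ | CoversWithRadius C ρ} R

/-- The length function: the smallest length of a linear code over `K` of codimension `r` and
covering radius `R`. It takes values in `ℕ∞` and is `⊤` if there is no such code, so that any
finite upper bound includes the existence of a code. -/
noncomputable def lengthFunction (K : Type*) [Field K] [DecidableEq K] (r R : ℕ) : ℕ∞ :=
  ⨅ (n : ℕ) (_ : ∃ C : Submodule K (Fin n → K), IsCoveringCode C r R), (n : ℕ∞)

/-- The projective space `PG(N, K)` of dimension `N` over `K`. -/
abbrev PG (N : ℕ) (K : Type*) [Field K] : Type _ := ℙ K (Fin (N + 1) → K)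

/-- Every point of `PG(N, K)` is a linear combination of at most `ρ + 1` points of `S`. -/
def SaturatesWith {K : Type*} [Field K] {N : ℕ} (S : Finset (PG N K)) (ρ : ℕ) : Prop :=
  ∀ A : PG N K, ∃ T : Finset (PG N K), T ⊆ S ∧ T.card ≤ ρ + 1 ∧
    A.submodule ≤ ⨆ P ∈ T, P.submodule

/-- `S` is a `ρ`-saturating set: every point is a linear combination of at most `ρ + 1` points
of `S`, and `ρ` is the smallest value with this property. -/
def IsSaturating {K : Type*} [Field K] {N : ℕ} (S : Finset (PG N K)) (ρ : ℕ) : Prop :=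
  IsLeast {ρ' : ℕ | SaturatesWith S ρ'} ρ

/-- The smallest size of a `ρ`-saturating set in `PG(N, K)` (`⊤` if there is none). -/
noncomputable def smallestSaturatingSize (K : Type*) [Field K] (N ρ : ℕ) : ℕ∞ :=
  ⨅ (S : Finset (PG N K)) (_ : IsSaturating S ρ), (S.card : ℕ∞)

/-- `m₁ = ⌈log_q (R + 1)⌉ + 1`. -/
noncomputable def mOne (q R : ℕ) : ℕ := ⌈Real.logb (q : ℝ) ((R : ℝ) + 1)⌉₊ + 1

/-- The bound `R q^((r-R)/R) + q^((r-2R)/R) + Δ` for `r = t R`; here `(r - j R) / R = t - j`.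
It is used for `t ≥ 2` only. -/
def lengthBound (q t R Δ : ℕ) : ℕ := R * q ^ (t - 1) + q ^ (t - 2) + Δ

/-! A code of codimension r and covering radius R amounts to n parity-check columns in an
r-dimensional space such that every syndrome is a combination of at most R columns, with R least
(`coversWithRadius_ker_iff`). Dropping zero columns and identifying proportional ones turns this
into an (R-1)-saturating set, whence the equality.

For t = 2, a set of Rq + 1 columns grows from the q + 1 points of a projective line. Each step
(`Good.next`) attaches a plane along one point P of the set and replaces P by q + 1 points of that
plane: the graph of a function f and the infinite point of its axis, which is the next P. A
representation that used P now uses two points of the plane; one that did not takes one extra point.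
Vectors of the old space use R + 1 old columns without P, so `Good` also records what the columns
other than P cover. The dimension grows by 2 and the radius by 1. Suitable f are tables for q = 5,
7, the indicator of an affinely rigid triple for q ≥ 8, and squaring for q = 4.

Except for q = 4, every vector is a combination with exactly R nonzero coefficients. This exactness
permits a concatenation with a rational normal curve over the extension of degree m = t - 2
(`comb_concatFam`), which needs Rq + 1 ≤ q^m + 1, that is R ≤ q^(t-3), and gives length (Rq +
1)q^(t-2). That is the bound without Δ, so a positive Δ is slack.

All this bounds the radius by R only; `Covers.exists_isLeast` makes it exactly R at the same length.
-/

/-! ### Combinations with a prescribed number of nonzero coefficients -/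

section Comb

variable (K : Type*) [Field K] {J L V W U : Type*}
  [AddCommGroup V] [Module K V] [AddCommGroup W] [Module K W] [AddCommGroup U] [Module K U]

/-- `v` is a linear combination of the members of `g` indexed by `T`, all coefficients being
nonzero. -/
def CombOn (g : J → V) (T : Finset J) (v : V) : Prop :=
  ∃ c : J → K, (∀ i ∈ T, c i ≠ 0) ∧ ∑ i ∈ T, c i • g i = v

/-- `v` is a linear combination with nonzero coefficients of `n` members of `g`, where `rel n k`.
For `rel = Eq` exactly `k` members are used, for `rel = LE.le` at most `k`. -/
def Comb (rel : ℕ → ℕ → Prop) (g : J → V) (k : ℕ) (v : V) : Prop :=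
  ∃ T : Finset J, rel T.card k ∧ CombOn K g T v

/-- The analogue of `Comb` for the family `g` extended by the vector `P`. -/
def CombP (rel : ℕ → ℕ → Prop) (g : J → V) (P : V) (k : ℕ) (v : V) : Prop :=
  Comb K rel g k v ∨ ∃ μ : K, μ ≠ 0 ∧ ∃ l, l + 1 = k ∧ Comb K rel g l (v - μ • P)

variable {K}

lemma CombOn.empty (g : J → V) : CombOn K g ∅ 0 := ⟨0, by simp, by simp⟩

lemma CombOn.insert [DecidableEq J] {g : J → V} {T : Finset J} {v w : V} (h : CombOn K g T v)
    {i : J} (hi : i ∉ T) {a : K} (ha : a ≠ 0) (hw : a • g i + v = w) :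
    CombOn K g (insert i T) w := by
  obtain ⟨c, hc, rfl⟩ := h
  refine ⟨Function.update c i a, ?_, ?_⟩
  · intro j hj
    by_cases hji : j = i
    · subst hji; simpa using ha
    · rw [Function.update_of_ne hji]
      exact hc j ((Finset.mem_insert.1 hj).resolve_left hji)
  · rw [Finset.sum_insert hi, Function.update_self, ← hw]
    congr 1
    refine Finset.sum_congr rfl fun j hj => ?_
    rw [Function.update_of_ne (by rintro rfl; exact hi hj)]

lemma CombOn.smul {g : J → V} {T : Finset J} {v : V} (h : CombOn K g T v) {a : K} (ha : a ≠ 0) :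
    CombOn K g T (a • v) := by
  obtain ⟨c, hc, rfl⟩ := h
  refine ⟨fun i => a * c i, fun i hi => mul_ne_zero ha (hc i hi), ?_⟩
  simp [Finset.smul_sum, mul_smul]

lemma CombOn.sumElim {g : J → V} {φ : L → W} {T : Finset J} {S : Finset L} {v : V} {w : W}
    (hv : CombOn K g T v) (hw : CombOn K φ S w) (A : V →ₗ[K] U) (B : W →ₗ[K] U) :
    CombOn K (Sum.elim (A ∘ g) (B ∘ φ)) (T.disjSum S) (A v + B w) := by
  obtain ⟨c, hc, rfl⟩ := hv
  obtain ⟨d, hd, rfl⟩ := hw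
  refine ⟨Sum.elim c d, ?_, ?_⟩
  · rintro (i | i) hi
    · exact hc i (by simpa using hi)
    · exact hd i (by simpa using hi)
  · simp [Finset.sum_disjSum]

lemma Comb.smul {rel : ℕ → ℕ → Prop} {g : J → V} {k : ℕ} {v : V} (h : Comb K rel g k v) {a : K}
    (ha : a ≠ 0) : Comb K rel g k (a • v) :=
  let ⟨T, hT, hc⟩ := h
  ⟨T, hT, hc.smul ha⟩

lemma CombP.smul {rel : ℕ → ℕ → Prop} {g : J → V} {P : V} {k : ℕ} {v : V}
    (h : CombP K rel g P k v) {a : K} (ha : a ≠ 0) : CombP K rel g P k (a • v) := by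
  rcases h with h | ⟨μ, hμ, l, hl, h⟩
  · exact .inl (h.smul ha)
  · refine .inr ⟨a * μ, mul_ne_zero ha hμ, l, hl, ?_⟩
    simpa [smul_sub, mul_smul] using h.smul ha

lemma Comb.sumElim {rel : ℕ → ℕ → Prop}
    (hadd : ∀ a b c d, rel a b → rel c d → rel (a + c) (b + d))
    {g : J → V} {φ : L → W} {k l : ℕ} {v : V} {w : W}
    (hv : Comb K rel g k v) (hw : Comb K rel φ l w) (A : V →ₗ[K] U) (B : W →ₗ[K] U) :
    Comb K rel (Sum.elim (A ∘ g) (B ∘ φ)) (k + l) (A v + B w) := by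
  obtain ⟨T, hT, hv⟩ := hv
  obtain ⟨S, hS, hw⟩ := hw
  exact ⟨T.disjSum S, by simpa using hadd _ _ _ _ hT hS, hv.sumElim hw A B⟩

lemma Comb.zero {rel : ℕ → ℕ → Prop} (hrefl : ∀ n, rel n n) (g : J → V) : Comb K rel g 0 0 :=
  ⟨∅, hrefl 0, CombOn.empty g⟩

lemma Comb.one {rel : ℕ → ℕ → Prop} (hrefl : ∀ n, rel n n) {g : J → V} (i : J) {a : K}
    (ha : a ≠ 0) {v : V} (hv : a • g i = v) : Comb K rel g 1 v := by
  classical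
  exact ⟨insert i ∅, by simpa using hrefl 1,
    (CombOn.empty g).insert (Finset.notMem_empty i) ha (by simpa using hv)⟩

lemma Comb.two {rel : ℕ → ℕ → Prop} (hrefl : ∀ n, rel n n) {g : J → V} {i j : J} (hij : i ≠ j)
    {a b : K} (ha : a ≠ 0) (hb : b ≠ 0) {v : V} (hv : a • g i + b • g j = v) :
    Comb K rel g 2 v := by
  classical
  refine ⟨{i, j}, by simpa [Finset.card_pair hij] using hrefl 2, ?_⟩
  exact (((CombOn.empty g).insert (Finset.notMem_empty j) hb rfl).insert (by simpa using hij) ha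
    (by simpa using hv))

lemma Comb.three {rel : ℕ → ℕ → Prop} (hrefl : ∀ n, rel n n) {g : J → V} {i j k : J}
    (hij : i ≠ j) (hik : i ≠ k) (hjk : j ≠ k) {a b c : K} (ha : a ≠ 0) (hb : b ≠ 0) (hc : c ≠ 0)
    {v : V} (hv : a • g i + (b • g j + c • g k) = v) : Comb K rel g 3 v := by
  classical
  refine ⟨{i, j, k}, by simpa [Finset.card_eq_three.2 ⟨i, j, k, hij, hik, hjk, rfl⟩] using hrefl 3,
    ?_⟩
  exact (((CombOn.empty g).insert (Finset.notMem_empty k) hc rfl).insert (by simpa using hjk) hb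
    rfl).insert (by simp [hij, hik]) ha (by simpa using hv)

lemma Comb.mono_le {g : J → V} {k l : ℕ} (hkl : k ≤ l) {v : V} (h : Comb K (· ≤ ·) g k v) :
    Comb K (· ≤ ·) g l v :=
  let ⟨T, hT, hc⟩ := h
  ⟨T, le_trans hT hkl, hc⟩

lemma Comb.mono_rel {rel rel' : ℕ → ℕ → Prop}
    (hrel : ∀ a b, rel a b → rel' a b) {g : J → V} {k : ℕ} {v : V} (h : Comb K rel g k v) :
    Comb K rel' g k v :=
  let ⟨T, hT, hc⟩ := h
  ⟨T, hrel _ _ hT, hc⟩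

end Comb

/-! ### Full-weight combinations of three points of a line -/

section Line

variable {K : Type*} [Field K] {J V : Type*} [AddCommGroup V] [Module K V]

lemma exists_ne_three {K : Type*} [Fintype K] (hK : 4 ≤ Fintype.card K) (a b c : K) :
    ∃ x : K, x ≠ a ∧ x ≠ b ∧ x ≠ c := by
  classical
  obtain ⟨x, hx⟩ : ∃ x, x ∉ ({a, b, c} : Finset K) := by
    by_contra! h
    have h1 : Finset.univ ⊆ ({a, b, c} : Finset K) := fun x _ => h x
    have := (Finset.card_le_card h1).trans Finset.card_le_three
    rw [Finset.card_univ] at this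
    omega
  exact ⟨x, by simpa using hx⟩

/-- Every vector `(x, z)` of the plane is a linear combination of `(1, y₀)`, `(1, y₁)`, `(1, y₂)`
with nonzero coefficients. -/
lemma exists_coeff_three [Fintype K] (hK : 4 ≤ Fintype.card K) {y₀ y₁ y₂ : K} (h01 : y₀ ≠ y₁)
    (h02 : y₀ ≠ y₂) (h12 : y₁ ≠ y₂) (x z : K) :
    ∃ a b c : K, a ≠ 0 ∧ b ≠ 0 ∧ c ≠ 0 ∧ a + b + c = x ∧ a * y₀ + b * y₁ + c * y₂ = z := by
  have e01 := sub_ne_zero.2 h01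
  -- Once c is chosen, a and b are determined by Cramer's rule; the last two excluded values are
  -- those for which b or a vanishes.
  obtain ⟨c, hc0, hc1, hc2⟩ := exists_ne_three hK 0 ((z - x * y₀) / (y₂ - y₀))
    ((z - x * y₁) / (y₂ - y₁))
  have e20 : y₂ - y₀ ≠ 0 := sub_ne_zero.2 h02.symm
  have e21 : y₂ - y₁ ≠ 0 := sub_ne_zero.2 h12.symm
  have e10 : y₁ - y₀ ≠ 0 := sub_ne_zero.2 h01.symm
  refine ⟨(z - x * y₁ - c * (y₂ - y₁)) / (y₀ - y₁), (z - x * y₀ - c * (y₂ - y₀)) / (y₁ - y₀), c,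
    div_ne_zero ?_ e01, div_ne_zero ?_ e10, hc0, ?_, ?_⟩
  · intro h
    exact hc2 (by rw [eq_div_iff e21]; linear_combination -h)
  · intro h
    exact hc1 (by rw [eq_div_iff e20]; linear_combination -h)
  · rw [← neg_sub y₀ y₁, div_neg]
    field_simp
    ring
  · rw [← neg_sub y₀ y₁, div_neg]
    field_simp
    ring

end Line

/-! ### The inductive construction of Rq + 1 columns in dimension 2R -/

section Construction

variable {K : Type*} [Field K]

/-- The affine part of the graph of `f`, in homogeneous coordinates. -/
def graphFam (f : K → K) (y : K) : K × K × K := (f y, 1, y)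

/-- The last unit vector of `K ^ 3`. -/
def vertical (K : Type*) [Field K] : K × K × K := (0, 0, 1)

/-- Conditions on the set formed by the graph of `f` and the infinite point of its `y`-axis, in the
plane with distinguished point `(1, 0, 0)`, that make the inductive construction work. -/
structure PlaneGood (rel : ℕ → ℕ → Prop) (f : K → K) : Prop where
  affine : ∀ y l, CombP K rel (graphFam f) (vertical K) 2 (l, 1, y)
  slope : ∀ l, l ≠ 0 → Comb K rel (graphFam f) 2 (l, 0, 1)
  infinity : CombP K rel (graphFam f) (vertical K) 2 (0, 0, 1)
  three : ∀ l, Comb K rel (graphFam f) 3 (l, 0, 1)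
  point : Comb K rel (graphFam f) 3 (1, 0, 0)
  graph : ∀ y, Comb K rel (graphFam f) 3 (f y, 1, y)

variable {J V : Type*} [AddCommGroup V] [Module K V]

/-- The family `g` together with the point `P` covers every vector using `R` members, and `g` alone
covers every vector using `R + 1`, `R + 2` or `R + 3` members, up to exceptions at `0` for small `R`. -/
structure Good (rel : ℕ → ℕ → Prop) (g : J → V) (P : V) (R : ℕ) : Prop where
  ne_zero : P ≠ 0
  cover : ∀ v, v ≠ 0 → CombP K rel g P R v
  cover_zero : 3 ≤ R → CombP K rel g P R 0
  succ : ∀ v, v ≠ 0 → Comb K rel g (R + 1) v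
  succ_zero : 2 ≤ R → Comb K rel g (R + 1) 0
  add : ∀ j, 2 ≤ j → j ≤ 3 → ∀ v, Comb K rel g (R + j) v

/-- The inclusion of the first summand. -/
def liftLeft : V →ₗ[K] V × K × K := LinearMap.inl K V (K × K)

/-- The embedding of a plane that maps its distinguished point to `P`. -/
def liftPlane (P : V) : K × K × K →ₗ[K] V × K × K :=
  LinearMap.prodMap (LinearMap.toSpanSingleton K V P) LinearMap.id

/-- The family obtained from `g` by replacing `P` by the graph of `f`. -/
def nextFam (g : J → V) (P : V) (f : K → K) : J ⊕ K → V × K × K :=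
  Sum.elim (liftLeft (K := K) ∘ g) (liftPlane P ∘ graphFam f)

variable {rel : ℕ → ℕ → Prop} {g : J → V} {P : V} {f : K → K} {R : ℕ}

lemma Comb.next (hadd : ∀ a b c d, rel a b → rel c d → rel (a + c) (b + d)) {k l n : ℕ} {v : V}
    {a b c : K} {w : V} (hv : Comb K rel g k v) (hw : Comb K rel (graphFam f) l (a, b, c))
    (hn : k + l = n) (hvw : v + a • P = w) : Comb K rel (nextFam g P f) n (w, b, c) := by
  have := hv.sumElim hadd hw liftLeft (liftPlane P)
  rw [hn] at this
  have e : liftLeft (K := K) v + liftPlane P (a, b, c) = (w, b, c) := by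
    rw [← hvw]
    simp [liftLeft, liftPlane]
  rwa [e] at this

lemma scale_triple (a l y : K) (ha : a ≠ 0) : a • ((l / a, 1, y / a) : K × K × K) = (l, a, y) := by
  simp [mul_div_cancel₀ _ ha]

lemma scale_triple_zero (l y : K) (hy : y ≠ 0) :
    y • ((l / y, 0, 1) : K × K × K) = (l, 0, y) := by
  simp [mul_div_cancel₀ _ hy]

lemma PlaneGood.slope' (hf : PlaneGood rel f) {l y : K} (hy : y ≠ 0) (hl : l ≠ 0) :
    Comb K rel (graphFam f) 2 (l, 0, y) := by
  rw [← scale_triple_zero l y hy]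
  exact (hf.slope _ (div_ne_zero hl hy)).smul hy

lemma PlaneGood.three' (hf : PlaneGood rel f) (l : K) {y : K} (hy : y ≠ 0) :
    Comb K rel (graphFam f) 3 (l, 0, y) := by
  rw [← scale_triple_zero l y hy]
  exact (hf.three _).smul hy

lemma PlaneGood.affine' (hf : PlaneGood rel f) {a : K} (y l : K) (ha : a ≠ 0) :
    CombP K rel (graphFam f) (vertical K) 2 (l, a, y) := by
  rw [← scale_triple a l y ha]
  exact (hf.affine _ _).smul ha

lemma PlaneGood.graph' (hf : PlaneGood rel f) {a : K} (y : K) (ha : a ≠ 0) :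
    Comb K rel (graphFam f) 3 (a * f (y / a), a, y) := by
  rw [← scale_triple a _ y ha, mul_div_cancel_left₀ _ ha]
  exact (hf.graph _).smul ha

lemma comb_graph_one (hrefl : ∀ n, rel n n) {a : K} (y : K) (ha : a ≠ 0) :
    Comb K rel (graphFam f) 1 (a * f (y / a), a, y) :=
  Comb.one hrefl (y / a) ha (by simp [graphFam, mul_div_cancel₀ _ ha])

/-- A representation in the plane combined with one by the family `g`. -/
lemma CombP.next (hadd : ∀ a b c d, rel a b → rel c d → rel (a + c) (b + d)) {k l n : ℕ} {v : V}
    {a b c : K} {w : V} (hv : Comb K rel g k v)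
    (hw : CombP K rel (graphFam f) (vertical K) l (a, b, c))
    (hn : k + l = n) (hvw : v + a • P = w) :
    CombP K rel (nextFam g P f) (0, 0, 1) n (w, b, c) := by
  rcases hw with hw | ⟨μ, hμ, m, rfl, hw⟩
  · exact .inl (hv.next hadd hw hn hvw)
  · refine .inr ⟨μ, hμ, k + m, by omega, ?_⟩
    have hw' : Comb K rel (graphFam f) m (a, b, c - μ) := by simpa [vertical] using hw
    simpa using hv.next hadd hw' rfl hvw

/-- Supplies the vectors whose part in the old space is zero while R < 3, where `cover_zero` is not
available: the plane alone represents them, with R + 1 = 2 or 3 points. -/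
lemma PlaneGood.extra (hrefl : ∀ n, rel n n)
    (hadd : ∀ a b c d, rel a b → rel c d → rel (a + c) (b + d)) (hf : PlaneGood rel f)
    (hg : Good (K := K) rel g P R) (hR : 1 ≤ R) {v : V} {a y : K}
    (h : v = 0) (hay : a ≠ 0 ∨ y ≠ 0) (ha : R < 3) :
    CombP K rel (nextFam g P f) (0, 0, 1) (R + 1) (v + (a * f (y / a)) • P, a, y) := by
  subst h
  have h0 := Comb.zero (K := K) hrefl g
  by_cases ha0 : a = 0
  · subst ha0
    have hy : y ≠ 0 := by simpa using hay
    simp only [zero_mul, zero_smul, add_zero]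
    obtain rfl | rfl : R = 1 ∨ R = 2 := by omega
    · have h2 : CombP K rel (graphFam f) (vertical K) 2 (0, 0, y) := by
        have := hf.infinity.smul hy
        simpa using this
      exact CombP.next hadd h0 h2 rfl (by simp)
    · exact .inl (h0.next hadd (hf.three' 0 hy) rfl (by simp))
  · obtain rfl | rfl : R = 1 ∨ R = 2 := by omega
    · exact CombP.next hadd h0 (hf.affine' y _ ha0) rfl rfl
    · exact .inl (h0.next hadd (hf.graph' y ha0) rfl rfl)

/-- Subtracting a times the graph point over y / a leaves a vector u of the old space (u = v if a =
0). If g represents u by R columns, that graph point, or the new P when a = 0, is added. If u uses P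
with coefficient μ, then μP is absorbed into the plane vector, which two plane points represent. -/
lemma Good.cover_next (hrefl : ∀ n, rel n n)
    (hadd : ∀ a b c d, rel a b → rel c d → rel (a + c) (b + d)) (hf : PlaneGood rel f)
    (hg : Good (K := K) rel g P R) (hR : 1 ≤ R) (v : V) (a y : K)
    (h : a ≠ 0 ∨ y ≠ 0 ∨ Comb K rel g (R + 1) v) :
    CombP K rel (nextFam g P f) (0, 0, 1) (R + 1) (v, a, y) := by
  by_cases hay : a ≠ 0 ∨ y ≠ 0
  · obtain ⟨u, hu⟩ : ∃ u, u + (a * f (y / a)) • P = v := ⟨v - (a * f (y / a)) • P, by abel⟩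
    by_cases hu0 : u = 0 ∧ R < 3
    · rw [← hu]
      exact hf.extra hrefl hadd hg hR hu0.1 hay hu0.2
    have hA : CombP K rel g P R u := by
      by_cases h0 : u = 0
      · rw [h0]
        exact hg.cover_zero (by by_contra h3; exact hu0 ⟨h0, by omega⟩)
      · exact hg.cover u h0
    by_cases ha : a = 0
    · subst ha
      have hy : y ≠ 0 := by simpa using hay
      obtain rfl : u = v := by simpa using hu
      rcases hA with hA | ⟨μ, hμ, l, rfl, hA⟩
      · refine .inr ⟨y, hy, R, rfl, ?_⟩
        have := hA.next (P := P) (w := u) hadd (Comb.zero (K := K) hrefl (graphFam f))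
          (a := 0) (b := 0) (c := 0) rfl (by simp)
        have e : ((u, 0, y) : V × K × K) - y • (0, 0, 1) = (u, 0, 0) := by simp; rfl
        rwa [e]
      · exact .inl (hA.next hadd (hf.slope' hy hμ) rfl (by simp))
    · rcases hA with hA | ⟨μ, hμ, l, rfl, hA⟩
      · exact .inl (hA.next hadd (comb_graph_one hrefl y ha) rfl hu)
      · refine CombP.next hadd hA (hf.affine' y (μ + a * f (y / a)) ha) rfl ?_
        rw [← hu, add_smul]
        abel
  · push Not at hay
    obtain ⟨rfl, rfl⟩ := hay
    have h1 : Comb K rel g (R + 1) v := by simpa using h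
    exact .inl (h1.next hadd (Comb.zero (K := K) hrefl _) (a := 0) (b := 0) (c := 0) rfl (by simp))

lemma Good.exists_sub_ne_zero [Fintype K] (hK : 4 ≤ Fintype.card K)
    (hg : Good (K := K) rel g P R) (v : V) : ∃ μ : K, μ ≠ 0 ∧ v - μ • P ≠ 0 := by
  obtain ⟨x, hx0, hx1, -⟩ := exists_ne_three hK 0 1 1
  by_cases h : v - (1 : K) • P = 0
  · refine ⟨x, hx0, fun h2 => hx1 ?_⟩
    have h3 : (x - 1) • P = 0 := by
      rw [sub_smul, ← sub_eq_zero.1 h, ← sub_eq_zero.1 h2, sub_self]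
    exact sub_eq_zero.1 ((smul_eq_zero.1 h3).resolve_right hg.ne_zero)
  · exact ⟨1, one_ne_zero, h⟩

/-- The new P is forbidden here. When a = 0, a multiple μP is moved from v into the plane; this
makes the old vector nonzero, so that `cover` and `succ` apply, and the plane direction nonzero, so
that `slope` applies. -/
lemma Good.add_next [Fintype K] (hK : 4 ≤ Fintype.card K) (hrefl : ∀ n, rel n n)
    (hadd : ∀ a b c d, rel a b → rel c d → rel (a + c) (b + d)) (hf : PlaneGood rel f)
    (hg : Good (K := K) rel g P R) (hR : 1 ≤ R) (j : ℕ) (hj1 : 1 ≤ j) (hj4 : j ≤ 3)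
    (v : V) (a y : K) : Comb K rel (nextFam g P f) (R + 1 + j) (v, a, y) := by
  by_cases ha : a = 0
  · subst ha
    by_cases hy : y = 0
    · subst hy
      have h0 := Comb.zero (K := K) hrefl (graphFam f)
      by_cases hj : j = 3
      · subst hj
        obtain ⟨μ, hμ, hv⟩ := hg.exists_sub_ne_zero hK v
        have h3 : Comb K rel (graphFam f) 3 (μ, 0, 0) := by simpa using hf.point.smul hμ
        exact (hg.succ _ hv).next hadd h3 rfl (by simp)
      · exact (hg.add (j + 1) (by omega) (by omega) v).next hadd (a := 0) (b := 0) (c := 0) h0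
          (by omega) (by simp)
    · obtain ⟨μ, hμ, hv⟩ := hg.exists_sub_ne_zero hK v
      obtain rfl | rfl | rfl : j = 1 ∨ j = 2 ∨ j = 3 := by omega
      · rcases hg.cover _ hv with h | ⟨κ, hκ, l, rfl, h⟩
        · exact h.next hadd (hf.slope' hy hμ) rfl (by simp)
        · refine h.next hadd (hf.three' (μ + κ) hy) (by omega) ?_
          rw [add_smul]
          abel
      · exact (hg.succ _ hv).next hadd (hf.slope' hy hμ) rfl (by simp)
      · exact (hg.add 2 le_rfl (by norm_num) (v - μ • P)).next hadd (hf.slope' hy hμ)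
          rfl (by simp)
  · obtain ⟨u, hu⟩ : ∃ u, u + (a * f (y / a)) • P = v := ⟨v - (a * f (y / a)) • P, by abel⟩
    by_cases hj : j = 1
    · subst hj
      by_cases hv : u = 0 ∧ R < 2
      · obtain ⟨rfl, hR2⟩ := hv
        obtain rfl : R = 1 := by omega
        exact (Comb.zero hrefl g).next hadd (hf.graph' y ha) rfl hu
      · have h1 : Comb K rel g (R + 1) u := by
          by_cases h0 : u = 0
          · rw [h0]
            exact hg.succ_zero (by by_contra h3; exact hv ⟨h0, by omega⟩)
          · exact hg.succ u h0
        exact h1.next hadd (comb_graph_one hrefl y ha) rfl hu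
    · exact (hg.add j (by omega) hj4 u).next hadd (comb_graph_one hrefl y ha) (by omega) hu

lemma Good.next [Fintype K] (hK : 4 ≤ Fintype.card K) (hrefl : ∀ n, rel n n)
    (hadd : ∀ a b c d, rel a b → rel c d → rel (a + c) (b + d)) (hf : PlaneGood rel f)
    (hg : Good (K := K) rel g P R) (hR : 1 ≤ R) :
    Good (K := K) rel (nextFam g P f) (0, 0, 1) (R + 1) where
  ne_zero := by simp
  cover := by
    rintro ⟨v, a, y⟩ h
    refine hg.cover_next hrefl hadd hf hR v a y ?_
    by_contra! h2
    obtain ⟨rfl, rfl, h3⟩ := h2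
    exact h3 (hg.succ v (by rintro rfl; exact h rfl))
  cover_zero h := hg.cover_next hrefl hadd hf hR 0 0 0 (.inr (.inr (hg.succ_zero (by omega))))
  succ := fun ⟨v, a, y⟩ _ => hg.add_next hK hrefl hadd hf hR 1 le_rfl (by norm_num) v a y
  succ_zero _ := hg.add_next hK hrefl hadd hf hR 1 le_rfl (by norm_num) 0 0 0
  add := fun j hj hj3 ⟨v, a, y⟩ => hg.add_next hK hrefl hadd hf hR j (by omega) hj3 v a y

/-- The affine points of the projective line. -/
def lineFam (y : K) : K × K := (1, y)

lemma good_lineFam [Fintype K] (hK : 4 ≤ Fintype.card K) (hrefl : ∀ n, rel n n) :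
    Good (K := K) rel (lineFam (K := K)) (0, 1) 1 := by
  have h3 : ∀ y₀ y₁ y₂ : K, y₀ ≠ y₁ → y₀ ≠ y₂ → y₁ ≠ y₂ → ∀ v,
      ∃ a b c : K, a ≠ 0 ∧ b ≠ 0 ∧ c ≠ 0 ∧
        a • lineFam y₀ + (b • lineFam y₁ + c • lineFam y₂) = v := by
    rintro y₀ y₁ y₂ h01 h02 h12 ⟨x, z⟩
    obtain ⟨a, b, c, ha, hb, hc, h1, h2⟩ := exists_coeff_three hK h01 h02 h12 x z
    refine ⟨a, b, c, ha, hb, hc, ?_⟩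
    simp [lineFam, ← h1, ← h2, add_assoc]
  obtain ⟨t, ht0, ht1, -⟩ := exists_ne_three hK 0 1 1
  refine ⟨by simp, ?_, by norm_num, ?_, by norm_num, ?_⟩
  · rintro ⟨x, z⟩ h
    by_cases hx : x = 0
    · subst hx
      refine .inr ⟨z, by rintro rfl; exact h rfl, 0, rfl, ?_⟩
      have e : ((0, z) : K × K) - z • (0, 1) = 0 := by simp
      rw [e]
      exact Comb.zero hrefl _
    · exact .inl (Comb.one hrefl (z / x) hx (by simp [lineFam, mul_div_cancel₀ _ hx]))
  · rintro ⟨x, z⟩ h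
    -- Two affine points other than the point represented by (x, z) itself; if x = 0 that point is
    -- at infinity and avoiding the default value 0 does no harm.
    obtain ⟨y₁, hy₁, -, -⟩ := exists_ne_three hK (z / x) 0 0
    obtain ⟨y₂, hy₂, hy, -⟩ := exists_ne_three hK (z / x) y₁ 0
    have key : ∀ y : K, y ≠ z / x → z - x * y ≠ 0 := by
      intro y hy h0
      by_cases hx : x = 0
      · subst hx
        exact h (by simpa using h0)
      · exact hy (by rw [eq_div_iff hx]; linear_combination -h0)
    have e : y₁ - y₂ ≠ 0 := sub_ne_zero.2 hy.symm
    refine Comb.two hrefl hy.symm (a := (z - x * y₂) / (y₁ - y₂))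
      (b := -((z - x * y₁) / (y₁ - y₂))) (div_ne_zero (key _ hy₂) e)
      (neg_ne_zero.2 (div_ne_zero (key _ hy₁) e)) ?_
    simp only [lineFam, Prod.smul_mk, Prod.mk_add_mk, smul_eq_mul, Prod.mk.injEq]
    constructor <;> field_simp <;> ring
  · intro j hj2 hj3 v
    obtain rfl | rfl : j = 2 ∨ j = 3 := by omega
    · obtain ⟨a, b, c, ha, hb, hc, h⟩ := h3 0 1 t zero_ne_one ht0.symm ht1.symm v
      exact Comb.three hrefl zero_ne_one ht0.symm ht1.symm ha hb hc h
    · classical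
      obtain ⟨s, hs0, hs1, hst⟩ := exists_ne_three hK 0 1 t
      -- For four points, one is used with coefficient 1 and the other three represent the rest.
      obtain ⟨a, b, c, ha, hb, hc, h⟩ := h3 0 1 t zero_ne_one ht0.symm ht1.symm (v - lineFam s)
      refine ⟨{s, 0, 1, t}, ?_, ((((CombOn.empty lineFam).insert (i := t) (by simp) hc rfl).insert
        (i := 1) (by simpa using ht1.symm) hb rfl).insert (i := 0) (by simpa using ht0.symm) ha
        rfl).insert (i := s) (by simp [hs0, hs1, hst]) (one_ne_zero (α := K)) ?_⟩
      · have : Finset.card ({s, 0, 1, t} : Finset K) = 4 := by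
          rw [Finset.card_insert_of_notMem (by simp [hs0, hs1, hst]),
            Finset.card_insert_of_notMem (by simpa using ht0.symm),
            Finset.card_pair ht1.symm]
        rw [this]
        exact hrefl 4
      · rw [add_zero, h]
        simp

universe u

/-- Starting from a projective line, `R - 1` steps of the construction give a set of `R q + 1`
points in a space of dimension `2 R`. -/
lemma exists_good {K : Type u} [Field K] [Fintype K] {rel : ℕ → ℕ → Prop}
    (hK : 4 ≤ Fintype.card K) (hrefl : ∀ n, rel n n)
    (hadd : ∀ a b c d, rel a b → rel c d → rel (a + c) (b + d)) {f : K → K}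
    (hf : PlaneGood rel f) (R : ℕ) (hR : 1 ≤ R) :
    ∃ (V : Type u) (_ : AddCommGroup V) (_ : Module K V) (_ : Module.Finite K V) (J : Type u)
      (_ : Fintype J) (g : J → V) (P : V), Good (K := K) rel g P R ∧
        Module.finrank K V = 2 * R ∧ Fintype.card J = R * Fintype.card K := by
  induction R, hR using Nat.le_induction with
  | base =>
    exact ⟨K × K, inferInstance, inferInstance, inferInstance, K, inferInstance, lineFam, (0, 1),
      good_lineFam hK hrefl, by simp, by simp⟩
  | succ R hR ih =>
    obtain ⟨V, _, _, _, J, _, g, P, hg, hV, hJ⟩ := ih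
    refine ⟨V × K × K, inferInstance, inferInstance, inferInstance, J ⊕ K, inferInstance,
      nextFam g P f, (0, 0, 1), hg.next hK hrefl hadd hf hR, ?_, ?_⟩
    · simp [hV]
      omega
    · simp [hJ, add_mul]

/-- The extension of the family `g` by the vector `P`. -/
def consFam (g : J → V) (P : V) (i : Option J) : V := i.elim P g

lemma CombP.consFam (hsucc : ∀ a b, rel a b → rel (a + 1) (b + 1)) {k : ℕ} {v : V}
    (h : CombP K rel g P k v) : Comb K rel (consFam g P) k v := by
  classical
  have key : ∀ (T : Finset J) (w : V), CombOn K g T w →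
      CombOn K (_root_.consFam g P) (T.map Function.Embedding.some) w := by
    rintro T w ⟨c, hc, rfl⟩
    refine ⟨fun i => i.elim 0 c, ?_, ?_⟩
    · intro i hi
      obtain ⟨j, hj, rfl⟩ := Finset.mem_map.1 hi
      exact hc j hj
    · simp [_root_.consFam]
  rcases h with ⟨T, hT, h⟩ | ⟨μ, hμ, l, rfl, T, hT, h⟩
  · exact ⟨_, by simpa using hT, key T _ h⟩
  · refine ⟨_, ?_, (key T _ h).insert (i := none) (by simp) hμ ?_⟩
    · rw [Finset.card_insert_of_notMem (by simp), Finset.card_map]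
      exact hsucc _ _ hT
    · simp [_root_.consFam]

end Construction

/-! ### Certificates for the plane conditions, and the fields of 5 and 7 elements -/

section Graphs

variable {K : Type*} [Field K] {rel : ℕ → ℕ → Prop} {f : K → K}

/-- An explicit form of `PlaneGood` with witnesses, which can be checked by computation. -/
def GraphCertificate (K : Type*) [CommRing K] (f : K → K) : Prop :=
  (∀ y l, (∃ z, z ≠ y ∧ f z = l) ∨ ∃ z w s, z ≠ w ∧ s ≠ 0 ∧ s ≠ 1 ∧ s * z + (1 - s) * w = y ∧
    s * f z + (1 - s) * f w = l) ∧
  (∀ l, ∃ z w s, z ≠ w ∧ s ≠ 0 ∧ s * (z - w) = 1 ∧ s * (f z - f w) = l) ∧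
  (∀ l, ∃ x z w s t, x ≠ z ∧ x ≠ w ∧ z ≠ w ∧ s ≠ 0 ∧ t ≠ 0 ∧ s + t ≠ 0 ∧
    s * (x - w) + t * (z - w) = 1 ∧ s * (f x - f w) + t * (f z - f w) = l) ∧
  (∃ x z w s t, x ≠ z ∧ x ≠ w ∧ z ≠ w ∧ s ≠ 0 ∧ t ≠ 0 ∧ s + t ≠ 0 ∧
    s * (x - w) + t * (z - w) = 0 ∧ s * (f x - f w) + t * (f z - f w) = 1) ∧
  (∀ y, ∃ x z w s t, x ≠ z ∧ x ≠ w ∧ z ≠ w ∧ s ≠ 0 ∧ t ≠ 0 ∧ s + t ≠ 1 ∧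
    s * (x - w) + t * (z - w) = y - w ∧ s * (f x - f w) + t * (f z - f w) = f y - f w)

lemma combP_graph_of_eq (hrefl : ∀ n, rel n n) {y z l : K} (hz : z ≠ y) (hl : f z = l) :
    CombP K rel (graphFam f) (vertical K) 2 (l, 1, y) := by
  refine .inr ⟨y - z, sub_ne_zero.2 hz.symm, 1, rfl, ?_⟩
  exact Comb.one hrefl z one_ne_zero (by simp [graphFam, vertical, hl])

lemma comb_graph_two (hrefl : ∀ n, rel n n) {z w s t a y l : K} (hzw : z ≠ w)
    (hs : s ≠ 0) (ht : t ≠ 0) (ha : s + t = a) (hy : s * z + t * w = y)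
    (hl : s * f z + t * f w = l) : Comb K rel (graphFam f) 2 (l, a, y) :=
  Comb.two hrefl hzw hs ht (by simp [graphFam, ha, hy, hl])

lemma comb_graph_three (hrefl : ∀ n, rel n n) {x z w s t u a y l : K} (hxz : x ≠ z) (hxw : x ≠ w)
    (hzw : z ≠ w) (hs : s ≠ 0) (ht : t ≠ 0) (hu : u ≠ 0) (ha : s + t + u = a)
    (hy : s * x + t * z + u * w = y) (hl : s * f x + t * f z + u * f w = l) :
    Comb K rel (graphFam f) 3 (l, a, y) :=
  Comb.three hrefl hxz hxw hzw hs ht hu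
    (by simp [graphFam, ← add_assoc, ha, hy, hl])

/-- The middle coordinate is the sum of the coefficients, so the last coefficient is 1 - s, -s, -(s
+ t) or 1 - s - t; the certificate omits it and only asks that it be nonzero. -/
lemma GraphCertificate.planeGood (hrefl : ∀ n, rel n n) (hf : GraphCertificate K f) :
    PlaneGood rel f := by
  obtain ⟨h1, h2, h3, h4, h5⟩ := hf
  have h2' : ∀ l, Comb K rel (graphFam f) 2 (l, 0, 1) := by
    intro l
    obtain ⟨z, w, s, hzw, hs, h, h'⟩ := h2 l
    exact comb_graph_two hrefl hzw hs (neg_ne_zero.2 hs) (by ring)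
      (by linear_combination h) (by linear_combination h')
  refine ⟨?_, fun l _ => h2' l, .inl (h2' 0), ?_, ?_, ?_⟩
  · intro y l
    rcases h1 y l with ⟨z, hz, hl⟩ | ⟨z, w, s, hzw, hs, hs1, h, h'⟩
    · exact combP_graph_of_eq hrefl hz hl
    · exact .inl (comb_graph_two hrefl hzw hs (sub_ne_zero.2 hs1.symm) (by ring) h h')
  · intro l
    obtain ⟨x, z, w, s, t, hxz, hxw, hzw, hs, ht, hst, h, h'⟩ := h3 l
    exact comb_graph_three hrefl hxz hxw hzw hs ht (neg_ne_zero.2 hst) (by ring)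
      (by linear_combination h) (by linear_combination h')
  · obtain ⟨x, z, w, s, t, hxz, hxw, hzw, hs, ht, hst, h, h'⟩ := h4
    exact comb_graph_three hrefl hxz hxw hzw hs ht (neg_ne_zero.2 hst) (by ring)
      (by linear_combination h) (by linear_combination h')
  · intro y
    obtain ⟨x, z, w, s, t, hxz, hxw, hzw, hs, ht, hst, h, h'⟩ := h5 y
    exact comb_graph_three hrefl hxz hxw hzw hs ht (sub_ne_zero.2 hst.symm) (by ring)
      (by linear_combination h) (by linear_combination h')

set_option synthInstance.maxHeartbeats 200000 in
set_option synthInstance.maxSize 1000 in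
instance (K : Type*) [CommRing K] [Fintype K] [DecidableEq K] (f : K → K) :
    Decidable (GraphCertificate K f) := by
  unfold GraphCertificate
  infer_instance

lemma GraphCertificate.map {F : Type*} [CommRing F] {f : F → F} (hf : GraphCertificate F f)
    (e : F ≃+* K) : GraphCertificate K (fun x => e (f (e.symm x))) := by
  have hne : ∀ {a b : F}, a ≠ b → e a ≠ e b := fun h => e.injective.ne h
  have h0 : ∀ {a : F}, a ≠ 0 → e a ≠ 0 := fun h => by simpa using h
  obtain ⟨h1, h2, h3, h4, h5⟩ := hf
  refine ⟨?_, ?_, ?_, ?_, ?_⟩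
  · intro y l
    obtain ⟨y, rfl⟩ := e.surjective y
    obtain ⟨l, rfl⟩ := e.surjective l
    rcases h1 y l with ⟨z, hz, hl⟩ | ⟨z, w, s, hzw, hs, hs1, h, h'⟩
    · exact .inl ⟨e z, hne hz, by simp [hl]⟩
    · exact .inr ⟨e z, e w, e s, hne hzw, h0 hs, by simpa using hs1, by simp [← h], by simp [← h']⟩
  · intro l
    obtain ⟨l, rfl⟩ := e.surjective l
    obtain ⟨z, w, s, hzw, hs, h, h'⟩ := h2 l
    exact ⟨e z, e w, e s, hne hzw, h0 hs, by simpa using congrArg e h, by simp [← h']⟩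
  · intro l
    obtain ⟨l, rfl⟩ := e.surjective l
    obtain ⟨x, z, w, s, t, hxz, hxw, hzw, hs, ht, hst, h, h'⟩ := h3 l
    exact ⟨e x, e z, e w, e s, e t, hne hxz, hne hxw, hne hzw, h0 hs, h0 ht,
      by simpa using h0 hst, by simpa using congrArg e h, by simp [← h']⟩
  · obtain ⟨x, z, w, s, t, hxz, hxw, hzw, hs, ht, hst, h, h'⟩ := h4
    exact ⟨e x, e z, e w, e s, e t, hne hxz, hne hxw, hne hzw, h0 hs, h0 ht,
      by simpa using h0 hst, by simpa using congrArg e h, by simpa using congrArg e h'⟩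
  · intro y
    obtain ⟨y, rfl⟩ := e.surjective y
    obtain ⟨x, z, w, s, t, hxz, hxw, hzw, hs, ht, hst, h, h'⟩ := h5 y
    exact ⟨e x, e z, e w, e s, e t, hne hxz, hne hxw, hne hzw, h0 hs, h0 ht,
      by simpa using hne hst, by simpa using congrArg e h, by simpa using congrArg e h'⟩

lemma exists_graphCertificate_five [Fintype K] (hK : Fintype.card K = 5) :
    ∃ f : K → K, GraphCertificate K f := by
  have h : GraphCertificate (ZMod 5)
      (fun x : ZMod 5 => (![0, 0, 1, 1, 2] : Fin 5 → ZMod 5) x) := by decide +kernel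
  exact ⟨_, h.map (ZMod.ringEquivOfPrime K (by norm_num) hK)⟩

lemma exists_graphCertificate_seven [Fintype K] (hK : Fintype.card K = 7) :
    ∃ f : K → K, GraphCertificate K f := by
  have h : GraphCertificate (ZMod 7)
      (fun x : ZMod 7 => (![0, 0, 0, 0, 1, 1, 2] : Fin 7 → ZMod 7) x) := by decide +kernel
  exact ⟨_, h.map (ZMod.ringEquivOfPrime K (by norm_num) hK)⟩

end Graphs

/-! ### Squaring for q = 4, and indicator functions for q ≥ 8 -/

section Graphs

variable {K : Type*} [Field K]

lemma planeGood_sq_of_card_eq_four [Fintype K] (hK : Fintype.card K = 4) :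
    PlaneGood (· ≤ ·) (fun x : K => x ^ 2) := by
  have hrefl : ∀ n : ℕ, n ≤ n := fun _ => le_rfl
  -- Squaring is an involution on the field of four elements, so the graph point at height l lies
  -- over l ^ 2.
  have h4 : ∀ x : K, (x ^ 2) ^ 2 = x := fun x => by
    rw [← pow_mul]
    have := FiniteField.pow_card x
    rwa [hK] at this
  obtain ⟨c, hc0, hc1, -⟩ := exists_ne_three hK.ge 0 1 0
  have e1 : c - 1 ≠ 0 := sub_ne_zero.2 hc1
  have hcc : c - c ^ 2 ≠ 0 := by
    intro h
    have : c * (c - 1) = 0 := by linear_combination -h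
    rcases mul_eq_zero.1 this with h | h
    · exact hc0 h
    · exact e1 h
  have h2 : (2 : K) = 0 := by
    have h : ((Fintype.card K : ℕ) : K) = 0 := FiniteField.cast_card_eq_zero K
    rw [hK] at h
    have : (2 : K) ^ 2 = 0 := by
      rw [← h]
      norm_num
    simpa using this
  have hc2 : c ^ 2 - 1 ≠ 0 := by
    intro h
    exact e1 (pow_eq_zero_iff two_ne_zero |>.1
      (by linear_combination h + (1 - c) * h2 : (c - 1) ^ 2 = 0))
  have hs : ∀ l : K, l ≠ 0 → Comb K (· ≤ ·) (graphFam fun x : K => x ^ 2) 2 (l, 0, 1) :=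
    fun l hl => comb_graph_two hrefl hl (inv_ne_zero hl) (neg_ne_zero.2 (inv_ne_zero hl))
      (by ring) (by simp [hl]) (by field_simp; ring)
  have h1 : ∀ y : K, Comb K (· ≤ ·) (graphFam fun x : K => x ^ 2) 1 (y ^ 2, 1, y) := fun y =>
    Comb.one hrefl y one_ne_zero (by simp [graphFam])
  refine ⟨?_, hs, ?_, ?_, ?_, fun y => (h1 y).mono_le (by norm_num)⟩
  · intro y l
    by_cases hy : l ^ 2 = y
    · subst hy
      have := (h1 (l ^ 2)).mono_le (l := 2) (by norm_num)
      rw [h4] at this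
      exact .inl this
    · exact combP_graph_of_eq hrefl hy (h4 l)
  · refine .inr ⟨1, one_ne_zero, 1, rfl, ?_⟩
    have e : ((0, 0, 1) : K × K × K) - (1 : K) • vertical K = 0 := by simp [vertical]
    rw [e]
    exact (Comb.zero hrefl _).mono_le (by norm_num)
  · intro l
    by_cases hl : l = 0
    · subst hl
      -- Squaring is injective, so two graph points never give the direction (0, 0, 1). The
      -- coefficients solve the Vandermonde system for 0, 1, c.
      exact comb_graph_three hrefl (x := 0) (z := 1) (w := c) (s := (c ^ 2 - 1) / (c - c ^ 2))
        (t := -(c ^ 2 / (c - c ^ 2))) (u := 1 / (c - c ^ 2)) zero_ne_one hc0.symm hc1.symm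
        (div_ne_zero hc2 hcc) (neg_ne_zero.2 (div_ne_zero (pow_ne_zero 2 hc0) hcc))
        (div_ne_zero one_ne_zero hcc) (by ring) (by field_simp; ring) (by ring)
    · exact (hs l hl).mono_le (by norm_num)
  · exact comb_graph_three hrefl (x := 0) (z := 1) (w := c) (s := (1 - c) / (c - c ^ 2))
      (t := c / (c - c ^ 2)) (u := -(1 / (c - c ^ 2))) zero_ne_one hc0.symm hc1.symm
      (div_ne_zero (sub_ne_zero.2 hc1.symm) hcc) (div_ne_zero hc0 hcc)
      (neg_ne_zero.2 (div_ne_zero one_ne_zero hcc)) (by ring) (by ring) (by field_simp; ring)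

/-- A set `{0, 1, c}` that is mapped to itself by no affine map other than the identity. -/
lemma exists_rigid_triple [Fintype K] (hK : 8 ≤ Fintype.card K) :
    ∃ c : K, c ≠ 0 ∧ c ≠ 1 ∧ ∀ m b : K, m ≠ 0 → (m ≠ 1 ∨ b ≠ 0) →
      ∃ x, (x = 0 ∨ x = 1 ∨ x = c) ∧ m * x + b ≠ 0 ∧ m * x + b ≠ 1 ∧ m * x + b ≠ c := by
  classical
  -- An affine map preserving {0, 1, c} permutes it. Transpositions force c = -1, 2 or 1/2, and
  -- 3-cycles force c² - c + 1 = 0, whose roots sum to 1. With 0 and 1 this excludes at most seven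
  -- values.
  obtain ⟨c, h0, h1, hn1, h2, h2', hr⟩ : ∃ c : K, c ≠ 0 ∧ c ≠ 1 ∧ c ≠ -1 ∧ c ≠ 2 ∧ 2 * c ≠ 1 ∧
      c ^ 2 - c + 1 ≠ 0 := by
    obtain ⟨r, hr⟩ : ∃ r : K, ∀ c, c ^ 2 - c + 1 = 0 → c = r ∨ c = 1 - r := by
      by_cases h : ∃ r : K, r ^ 2 - r + 1 = 0
      · obtain ⟨r, hr⟩ := h
        refine ⟨r, fun c hc => ?_⟩
        have : (c - r) * (c - (1 - r)) = 0 := by linear_combination hc - hr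
        rcases mul_eq_zero.1 this with h | h
        · exact .inl (sub_eq_zero.1 h)
        · exact .inr (sub_eq_zero.1 h)
      · exact ⟨0, fun c hc => (h ⟨c, hc⟩).elim⟩
    obtain ⟨c, hc⟩ : ∃ c, c ∉ ({0, 1, -1, 2, 2⁻¹, r, 1 - r} : Finset K) := by
      by_contra! h
      have h1 : Finset.univ ⊆ ({0, 1, -1, 2, 2⁻¹, r, 1 - r} : Finset K) := fun x _ => h x
      have h2 := Finset.card_le_card h1
      rw [Finset.card_univ] at h2
      have h3 : ({0, 1, -1, 2, 2⁻¹, r, 1 - r} : Finset K).card ≤ 7 :=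
        (Finset.card_insert_le _ _).trans (Nat.succ_le_succ Finset.card_le_six)
      omega
    simp only [Finset.mem_insert, Finset.mem_singleton, not_or] at hc
    obtain ⟨h0, h1, hn1, h2, h2', hr1, hr2⟩ := hc
    refine ⟨c, h0, h1, hn1, h2, fun h => h2' (eq_inv_of_mul_eq_one_right h),
      fun h => (hr c h).elim hr1 hr2⟩
  refine ⟨c, h0, h1, fun m b hm hmb => ?_⟩
  by_contra! H
  have H0 : b = 0 ∨ b = 1 ∨ b = c := by
    have := H 0 (.inl rfl)
    simp only [mul_zero, zero_add] at this
    tauto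
  have H1 : m + b = 0 ∨ m + b = 1 ∨ m + b = c := by
    have := H 1 (.inr (.inl rfl))
    simp only [mul_one] at this
    tauto
  have Hc : m * c + b = 0 ∨ m * c + b = 1 ∨ m * c + b = c := by
    have := H c (.inr (.inr rfl))
    tauto
  clear H
  have c1 : c - 1 ≠ 0 := sub_ne_zero.2 h1
  rcases H0 with rfl | rfl | rfl <;> rcases H1 with H1 | H1 | H1 <;>
    rcases Hc with Hc | Hc | Hc <;> grind

lemma exists_graphCertificate_of_eight_le [Fintype K] (hK : 8 ≤ Fintype.card K) :
    ∃ f : K → K, GraphCertificate K f := by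
  classical
  have hK4 : 4 ≤ Fintype.card K := by omega
  obtain ⟨c, hc0, hc1, hc⟩ := exists_rigid_triple hK
  obtain ⟨f, hf⟩ : ∃ f : K → K, f = fun x => if x = 0 ∨ x = 1 ∨ x = c then 1 else 0 := ⟨_, rfl⟩
  have f1 : ∀ x, (x = 0 ∨ x = 1 ∨ x = c) → f x = 1 := fun x hx => by simp [hf, hx]
  have f0 : ∀ x, x ≠ 0 → x ≠ 1 → x ≠ c → f x = 0 := fun x h1 h2 h3 => by simp [hf, h1, h2, h3]
  have hY : ∀ a b : K, ∃ w, f w = 0 ∧ w ≠ 0 ∧ w ≠ 1 ∧ w ≠ c ∧ w ≠ a ∧ w ≠ b := by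
    intro a b
    obtain ⟨w, hw⟩ : ∃ w, w ∉ ({0, 1, c, a, b} : Finset K) := by
      by_contra! h
      have h1 : Finset.univ ⊆ ({0, 1, c, a, b} : Finset K) := fun x _ => h x
      have h2 := (Finset.card_le_card h1).trans Finset.card_le_five
      rw [Finset.card_univ] at h2
      omega
    simp only [Finset.mem_insert, Finset.mem_singleton, not_or] at hw
    obtain ⟨w0, w1, wc, wa, wb⟩ := hw
    exact ⟨w, f0 w w0 w1 wc, w0, w1, wc, wa, wb⟩
  have f00 : f 0 = 1 := f1 0 (.inl rfl)
  refine ⟨f, ?_, ?_, ?_, ?_, ?_⟩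
  · intro y l
    by_cases hl1 : l = 1
    · subst hl1
      by_cases hy : y = 0
      · exact .inl ⟨1, by simp [hy], f1 1 (.inr (.inl rfl))⟩
      · exact .inl ⟨0, Ne.symm hy, f00⟩
    by_cases hl0 : l = 0
    · obtain ⟨w, hw, -, -, -, hwy, -⟩ := hY y y
      exact .inl ⟨w, hwy, hw.trans hl0.symm⟩
    have e : 1 - l ≠ 0 := sub_ne_zero.2 (Ne.symm hl1)
    -- With weights l and 1 - l on a point x of the triple and a point w outside it, height l is
    -- automatic and w must be this affine image of x. The slope is never 1, so rigidity gives an x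
    -- whose image leaves the triple.
    obtain ⟨x, hx, h0, h1, h2⟩ := hc (-l / (1 - l)) (y / (1 - l))
      (div_ne_zero (neg_ne_zero.2 hl0) e) (.inl fun h => by
        rw [div_eq_one_iff_eq e] at h
        exact one_ne_zero (α := K) (by linear_combination -h))
    refine .inr ⟨x, -l / (1 - l) * x + y / (1 - l), l, ?_, hl0, hl1, ?_, ?_⟩
    · intro h
      rw [← h] at h0 h1 h2
      tauto
    · field_simp
      ring
    · rw [f1 x hx, f0 _ h0 h1 h2]
      ring
  · intro l
    by_cases hl : l = 0
    · obtain ⟨z, hz, -⟩ := hY 0 0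
      obtain ⟨w, hw, -, -, -, hwz, -⟩ := hY z z
      have e := sub_ne_zero.2 hwz.symm
      exact ⟨z, w, (z - w)⁻¹, hwz.symm, inv_ne_zero e, inv_mul_cancel₀ e, by simp [hz, hw, hl]⟩
    · obtain ⟨x, hx, h0, h1, h2⟩ := hc 1 (-l⁻¹) one_ne_zero (.inr (by simpa using hl))
      refine ⟨x, 1 * x + -l⁻¹, l, ?_, hl, by field_simp; ring, ?_⟩
      · intro h
        rw [← h] at h0 h1 h2
        tauto
      · rw [f1 x hx, f0 _ h0 h1 h2]
        ring
  · intro l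
    by_cases hl : l = 0
    · obtain ⟨x, hx, -⟩ := hY 0 0
      obtain ⟨z, hz, -, -, -, hzx, -⟩ := hY x x
      obtain ⟨w, hw, -, -, -, hwx, hwz⟩ := hY x z
      obtain ⟨s, t, u, hs, ht, hu, h, h'⟩ :=
        exists_coeff_three hK4 hzx.symm hwx.symm hwz.symm 0 1
      refine ⟨x, z, w, s, t, hzx.symm, hwx.symm, hwz.symm, hs, ht, ?_,
        by linear_combination h' - w * h, by simp [hx, hz, hw, hl]⟩
      intro h0
      exact hu (by linear_combination h - h0)
    -- Only the point over 0 has height 1, so its coefficient is l. Avoiding -l⁻¹ keeps the other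
    -- two coefficients nonzero.
    · obtain ⟨z, hz, hz0, -, -, hzl, -⟩ := hY (-l⁻¹) 0
      obtain ⟨w, hw, hw0, -, -, hwl, hwz⟩ := hY (-l⁻¹) z
      have e := sub_ne_zero.2 hwz.symm
      have key : ∀ v : K, v ≠ -l⁻¹ → 1 + l * v ≠ 0 := by
        intro v hv h
        refine hv ?_
        field_simp
        linear_combination h
      refine ⟨0, z, w, l, (1 + l * w) / (z - w), hz0.symm, hw0.symm, hwz.symm, hl,
        div_ne_zero (key w hwl) e, ?_, by field_simp; ring, by rw [f00, hz, hw]; ring⟩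
      have : l + (1 + l * w) / (z - w) = (1 + l * z) / (z - w) := by
        field_simp
        ring
      rw [this]
      exact div_ne_zero (key z hzl) e
  · obtain ⟨z, hz, hz0, -⟩ := hY 0 0
    obtain ⟨w, hw, hw0, -, -, hwz, -⟩ := hY z z
    have e := sub_ne_zero.2 hwz.symm
    refine ⟨0, z, w, 1, w / (z - w), hz0.symm, hw0.symm, hwz.symm, one_ne_zero,
      div_ne_zero hw0 e, ?_, by field_simp; ring, by rw [f00, hz, hw]; ring⟩
    have : 1 + w / (z - w) = z / (z - w) := by
      field_simp
      ring
    rw [this]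
    exact div_ne_zero hz0 e
  · intro y
    -- Three graph points at the height of y are collinear with the target, and `exists_coeff_three`
    -- applies on that line.
    obtain ⟨x, z, w, hxz, hxw, hzw, hx, hz, hw⟩ : ∃ x z w : K, x ≠ z ∧ x ≠ w ∧ z ≠ w ∧
        f x = f y ∧ f z = f y ∧ f w = f y := by
      by_cases hy : y = 0 ∨ y = 1 ∨ y = c
      · rw [f1 y hy]
        exact ⟨0, 1, c, zero_ne_one, hc0.symm, hc1.symm, f00, f1 1 (.inr (.inl rfl)),
          f1 c (.inr (.inr rfl))⟩
      · push Not at hy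
        rw [f0 y hy.1 hy.2.1 hy.2.2]
        obtain ⟨x, hx, -⟩ := hY 0 0
        obtain ⟨z, hz, -, -, -, hzx, -⟩ := hY x x
        obtain ⟨w, hw, -, -, -, hwx, hwz⟩ := hY x z
        exact ⟨x, z, w, hzx.symm, hwx.symm, hwz.symm, hx, hz, hw⟩
    obtain ⟨s, t, u, hs, ht, hu, h, h'⟩ := exists_coeff_three hK4 hxz hxw hzw 1 y
    refine ⟨x, z, w, s, t, hxz, hxw, hzw, hs, ht, ?_, by linear_combination h' - w * h,
      by simp [hx, hz, hw]⟩
    intro h0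
    exact hu (by linear_combination h - h0)

end Graphs

/-! ### Concatenation with a rational normal curve -/

section Lifting

variable {K : Type*} [Field K] {ι V : Type*} [AddCommGroup V] [Module K V]
  {E : Type*} [Field E] [Algebra K E]

/-- First homogeneous coordinate of a point of the projective line over `E`. -/
def projX (x : Option E) : E := x.elim 1 id

/-- Second homogeneous coordinate of a point of the projective line over `E`. -/
def projY (x : Option E) : E := x.elim 0 fun _ => 1

lemma projX_mul_projY_ne {x y : Option E} (h : x ≠ y) :
    projX x * projY y - projX y * projY x ≠ 0 := by
  cases x <;> cases y <;> simp_all [projX, projY, sub_eq_zero]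

/-- The `q ^ m`-concatenating construction: each vector `h i` is extended by all `E`-multiples of
the point with parameter `ν i` of the rational normal curve. -/
def concatFam (h : ι → V) (ν : ι → Option E) (R : ℕ) (p : ι × E) : V × (Fin R → E) :=
  (h p.1, p.2 • Matrix.rectVandermonde (projX ∘ ν) (projY ∘ ν) R p.1)

/-- The first component selects exactly R columns. Their points on the rational normal curve are
distinct, hence a basis of E^R by the projective Vandermonde determinant, and suitable E-multiples
give any second component. With fewer than R columns they would not span. -/
lemma comb_concatFam {h : ι → V} {ν : ι → Option E} (hν : Function.Injective ν) {R : ℕ}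
    (hh : ∀ v, Comb K (· = ·) h R v) (x : V × (Fin R → E)) :
    Comb K (· = ·) (concatFam h ν R) R x := by
  classical
  obtain ⟨u, W⟩ := x
  obtain ⟨T, hT, c, hc, rfl⟩ := hh u
  let e : Fin R ≃ T := (finCongr hT.symm).trans T.equivFin.symm
  let M : Matrix (Fin R) (Fin R) E :=
    Matrix.projVandermonde (fun i => projX (ν (e i))) (fun i => projY (ν (e i)))
  have hM : IsUnit M.det := by
    rw [isUnit_iff_ne_zero, Matrix.det_projVandermonde]
    refine Finset.prod_ne_zero_iff.2 fun i _ => Finset.prod_ne_zero_iff.2 fun j hj => ?_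
    have hij : j ≠ i := (Finset.mem_Ioi.1 hj).ne'
    exact projX_mul_projY_ne (hν.ne fun h => hij (e.injective (Subtype.ext h)))
  let η : Fin R → E := Matrix.vecMul W M⁻¹
  have hη : Matrix.vecMul η M = W := by
    simp [η, Matrix.vecMul_vecMul, Matrix.nonsing_inv_mul _ hM]
  -- The coefficient of the column is already fixed by the first component, so its inverse is built
  -- into the multiplier.
  let s : Fin R ↪ ι × E := ⟨fun i => ((e i : ι), (c (e i))⁻¹ • η i), fun i j hij =>
    e.injective (Subtype.ext (Prod.ext_iff.1 hij).1)⟩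
  refine ⟨Finset.univ.map s, by simp, fun p => c p.1, ?_, ?_⟩
  · intro p hp
    obtain ⟨i, -, rfl⟩ := Finset.mem_map.1 hp
    exact hc _ (e i).2
  · rw [Finset.sum_map]
    refine Prod.ext ?_ ?_
    · rw [Prod.fst_sum, ← Finset.sum_coe_sort T]
      exact e.sum_comp fun i : T => c i • h i
    · rw [Prod.snd_sum]
      refine Eq.trans ?_ hη
      ext k
      rw [Finset.sum_apply]
      refine Finset.sum_congr rfl fun i _ => ?_
      have hci : c (e i) ≠ 0 := hc _ (e i).2
      change c (e i) • (((c (e i))⁻¹ • η i) *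
        Matrix.rectVandermonde (projX ∘ ν) (projY ∘ ν) R (e i) k) = _
      rw [← smul_mul_assoc, smul_inv_smul₀ hci]
      rfl

lemma exists_injective_option {ι E : Type*} [Fintype ι] [Fintype E]
    (h : Fintype.card ι ≤ Fintype.card E + 1) : ∃ ν : ι → Option E, Function.Injective ν := by
  rw [← Fintype.card_option] at h
  exact ⟨_, (Function.Embedding.nonempty_of_card_le h).some.injective⟩

/-- A family of `n` vectors of which every vector is a combination with exactly `R` nonzero
coefficients lifts to `n q ^ m` vectors in a space of dimension larger by `R m`. -/
lemma exists_comb_lift [Fintype K] [Module.Finite K V] [Fintype ι] {h : ι → V} {R : ℕ}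
    (hh : ∀ v, Comb K (· = ·) h R v) (m : ℕ) (hm : m ≠ 0)
    (hcard : Fintype.card ι ≤ Fintype.card K ^ m + 1) :
    ∃ (E : Type) (_ : Fintype E) (_ : AddCommGroup E) (_ : Module K E)
      (h' : ι × E → V × (Fin R → E)), Module.Finite K (V × (Fin R → E)) ∧
      (∀ v, Comb K (· = ·) h' R v) ∧ Fintype.card E = Fintype.card K ^ m ∧
      Module.finrank K (V × (Fin R → E)) = Module.finrank K V + R * m := by
  obtain ⟨p, hp⟩ := CharP.exists K
  have : Fact p.Prime := ⟨CharP.char_is_prime K p⟩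
  have : NeZero m := ⟨hm⟩
  let E := FiniteField.Extension K p m
  have : Fintype E := Fintype.ofFinite E
  have hE : Fintype.card E = Fintype.card K ^ m := by
    rw [← Nat.card_eq_fintype_card, ← Nat.card_eq_fintype_card]
    exact FiniteField.natCard_extension K p m
  have hE2 : Module.finrank K E = m := FiniteField.finrank_extension K p m
  obtain ⟨ν, hν⟩ := exists_injective_option (E := E) (hE ▸ hcard)
  refine ⟨E, inferInstance, inferInstance, inferInstance, concatFam h ν R, inferInstance,
    comb_concatFam hν hh, hE, ?_⟩
  simp [Module.finrank_pi_fintype, hE2]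

end Lifting

/-! ### Raising the covering radius to exactly R -/

section Radius

variable {K : Type*} [Field K] {ι V : Type*} [AddCommGroup V] [Module K V]

variable (K) in
/-- Every vector is a linear combination of at most `ρ` members of the family `h`. -/
def Covers (h : ι → V) (ρ : ℕ) : Prop := ∀ v, Comb K (· ≤ ·) h ρ v

lemma Covers.mono {h : ι → V} {ρ σ : ℕ} (hh : Covers K h ρ) (hρ : ρ ≤ σ) : Covers K h σ :=
  fun v => (hh v).mono_le hρ

/-- A combination of the members of `h` indexed by `T` whose coefficients may vanish. -/
lemma comb_le_of_sum [DecidableEq K] {h : ι → V} (T : Finset ι) (c : ι → K) {k : ℕ}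
    (hk : (T.filter (c · ≠ 0)).card ≤ k) : Comb K (· ≤ ·) h k (∑ i ∈ T, c i • h i) := by
  refine ⟨T.filter (c · ≠ 0), hk, c, fun i hi => (Finset.mem_filter.1 hi).2, ?_⟩
  refine Finset.sum_subset (Finset.filter_subset _ _) fun i hi hn => ?_
  have : c i = 0 := by
    by_contra h0
    exact hn (Finset.mem_filter.2 ⟨hi, h0⟩)
  simp [this]

lemma Covers.span_eq_top {h : ι → V} {ρ : ℕ} (hh : Covers K h ρ) :
    Submodule.span K (Set.range h) = ⊤ := by
  refine eq_top_iff.2 fun v _ => ?_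
  obtain ⟨T, -, c, -, rfl⟩ := hh v
  exact Submodule.sum_mem _ fun i _ =>
    Submodule.smul_mem _ _ (Submodule.subset_span (Set.mem_range_self i))

/-- Each use of column i is compensated by a multiple of column j, so at most one column joins the
support. -/
lemma Covers.update [Fintype ι] [DecidableEq ι] {h : ι → V} {ρ : ℕ} (hh : Covers K h ρ) {i j : ι}
    (hij : j ≠ i) (a : K) : Covers K (Function.update h i (h i - a • h j)) (ρ + 1) := by
  classical
  intro v
  obtain ⟨T, hT, c, hc, rfl⟩ := hh v
  let d : ι → K := fun k => if k ∈ T then c k else 0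
  have hd : ∑ k ∈ T, c k • h k = ∑ k, d k • h k := by
    simp [d, ite_smul]
  obtain ⟨d', hd'⟩ : ∃ d' : ι → K, d' = d + Pi.single j (d i * a) := ⟨_, rfl⟩
  have hsupp : Finset.univ.filter (fun k => d' k ≠ 0) ⊆ insert j T := by
    intro k hk
    rw [Finset.mem_insert]
    by_contra! hn
    simp [hd', d, hn.1, hn.2] at hk
  have key := comb_le_of_sum (h := Function.update h i (h i - a • h j)) Finset.univ
    d' (k := ρ + 1)
    ((Finset.card_le_card hsupp).trans ((Finset.card_insert_le _ _).trans (by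
      simpa using hT)))
  convert key using 1
  rw [hd]
  have e : ∀ k, d' k • Function.update h i (h i - a • h j) k =
      d k • h k - (Pi.single i ((d i * a) • h j) : ι → V) k
        + (Pi.single j ((d i * a) • h j) : ι → V) k := by
    intro k
    rw [hd']
    by_cases hki : k = i
    · subst hki
      simp [hij.symm, smul_sub, mul_smul]
    · by_cases hkj : k = j
      · subst hkj
        simp [hij, add_smul]
      · simp [hki, hkj]
  rw [Finset.sum_congr rfl fun k _ => e k, Finset.sum_add_distrib, Finset.sum_sub_distrib]
  simp

/-- Any family with covering radius at most `R` may be modified into one, with as many members,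
whose covering radius is exactly `R`. -/
lemma Covers.exists_isLeast [Fintype ι] [Module.Finite K V] {h : ι → V} {R : ℕ}
    (hh : Covers K h R) (hR : R ≤ Module.finrank K V) :
    ∃ h' : ι → V, IsLeast {ρ | Covers K h' ρ} R := by
  classical
  obtain ⟨κ, e, he, hspan, hli⟩ := exists_linearIndependent' K h
  let b : Module.Basis κ K V := Module.Basis.mk hli (by rw [hspan, hh.span_eq_top])
  have : Fintype κ := FiniteDimensional.fintypeBasisIndex b
  have hb : ∀ k, h (e k) = b k := fun k => by simp [b]
  -- The basis must stay fixed while h changes; only the columns outside it will be modified.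
  clear_value b
  have hcard : Fintype.card κ = Module.finrank K V := (Module.finrank_eq_card_basis b).symm
  clear hspan hli
  -- While the radius is below R, one basis coordinate of a column outside the basis is cleared.
  -- This lowers N and raises the radius by at most one, so R is never overshot.
  obtain ⟨N, hN⟩ : ∃ N, N = ∑ i, (b.repr (h i)).support.card := ⟨_, rfl⟩
  induction N using Nat.strong_induction_on generalizing h with
  | _ N ih =>
    by_cases hlt : ∃ ρ < R, Covers K h ρ
    · obtain ⟨ρ, hρ, hc⟩ := hlt
      -- Otherwise only the basis columns matter, and the sum of all basis vectors needs `finrank K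
      -- V` ≥ R of them.
      have hex : ∃ i, i ∉ Set.range e ∧ h i ≠ 0 := by
        by_contra! h0
        obtain ⟨T, hT, c, -, hsum⟩ := hc (∑ k, b k)
        have hTe : ∀ k, ∃ i ∈ T, e k = i := by
          intro k
          by_contra! hn
          have h1 : b.repr (∑ i ∈ T, c i • h i) k = 0 := by
            rw [map_sum, Finsupp.finsetSum_apply]
            refine Finset.sum_eq_zero fun i hi => ?_
            by_cases hie : i ∈ Set.range e
            · obtain ⟨l, rfl⟩ := hie
              have : l ≠ k := by
                rintro rfl
                exact hn _ hi rfl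
              simp [hb, this]
            · simp [h0 i hie]
          rw [hsum, map_sum, Finsupp.finsetSum_apply] at h1
          simp [Finsupp.single_apply] at h1
        have h2 : Finset.univ.map ⟨e, he⟩ ⊆ T := by
          intro i hi
          obtain ⟨k, -, rfl⟩ := Finset.mem_map.1 hi
          obtain ⟨i, hi, h3⟩ := hTe k
          change e k ∈ T
          rwa [h3]
        have h3 := Finset.card_le_card h2
        rw [Finset.card_map, Finset.card_univ] at h3
        omega
      obtain ⟨i, hie, hi⟩ := hex
      obtain ⟨k, hk⟩ : ∃ k, b.repr (h i) k ≠ 0 := by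
        by_contra! h0
        exact hi (b.repr.map_eq_zero_iff.1 (Finsupp.ext h0))
      have hki : e k ≠ i := fun h0 => hie ⟨k, h0⟩
      refine ih _ ?_ (h := Function.update h i (h i - b.repr (h i) k • h (e k)))
        ((hc.update hki _).mono hρ) ?_ rfl
      · rw [hN]
        refine Finset.sum_lt_sum (fun j _ => ?_) ⟨i, Finset.mem_univ i, ?_⟩
        · by_cases hji : j = i
          · subst hji
            rw [Function.update_self]
            refine Finset.card_le_card fun l hl => ?_
            by_cases hlk : l = k
            · subst hlk
              simpa using hk
            · simpa [hb, Finsupp.single_apply, Ne.symm hlk] using hl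
          · rw [Function.update_of_ne hji]
        · rw [Function.update_self]
          refine Finset.card_lt_card ((Finset.ssubset_iff_of_subset fun l hl => ?_).2
            ⟨k, by simpa using hk, by simp [hb]⟩)
          by_cases hlk : l = k
          · subst hlk
            simpa using hk
          · simpa [hb, Finsupp.single_apply, Ne.symm hlk] using hl
      · intro l
        rw [Function.update_of_ne (fun h0 => hie ⟨l, h0⟩), hb]
    · exact ⟨h, hh, fun ρ hρ => by
        by_contra! h0
        exact hlt ⟨ρ, h0, hρ⟩⟩

end Radius

/-! ### Invariance under linear equivalences and reindexing -/

section Transfer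

variable {K : Type*} [Field K] {ι κ V W : Type*} [AddCommGroup V] [Module K V]
  [AddCommGroup W] [Module K W]

lemma CombOn.map {h : ι → V} {T : Finset ι} {v : V} (hv : CombOn K h T v) (e : V →ₗ[K] W) :
    CombOn K (e ∘ h) T (e v) := by
  obtain ⟨c, hc, rfl⟩ := hv
  exact ⟨c, hc, by simp⟩

lemma Covers.map {h : ι → V} {ρ : ℕ} (hh : Covers K h ρ) (e : V ≃ₗ[K] W) :
    Covers K (e ∘ h) ρ := by
  intro w
  obtain ⟨T, hT, hc⟩ := hh (e.symm w)
  exact ⟨T, hT, by simpa using hc.map (e : V →ₗ[K] W)⟩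

lemma covers_map_iff {h : ι → V} {ρ : ℕ} (e : V ≃ₗ[K] W) :
    Covers K (e ∘ h) ρ ↔ Covers K h ρ := by
  refine ⟨fun hh => ?_, fun hh => hh.map e⟩
  have := hh.map e.symm
  rwa [← Function.comp_assoc, show (e.symm ∘ e : V → V) = id from funext e.symm_apply_apply,
    Function.id_comp] at this

lemma Covers.reindex {h : ι → V} {ρ : ℕ} (hh : Covers K h ρ) (e : κ ≃ ι) :
    Covers K (h ∘ e) ρ := by
  intro v
  obtain ⟨T, hT, c, hc, rfl⟩ := hh v
  refine ⟨T.map e.symm.toEmbedding, by simpa using hT, c ∘ e, ?_, by simp⟩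
  intro i hi
  obtain ⟨j, hj, rfl⟩ := Finset.mem_map.1 hi
  simpa using hc j hj

lemma covers_reindex_iff {h : ι → V} {ρ : ℕ} (e : κ ≃ ι) :
    Covers K (h ∘ e) ρ ↔ Covers K h ρ := by
  refine ⟨fun hh => ?_, fun hh => hh.reindex e⟩
  have := hh.reindex e.symm
  rwa [Function.comp_assoc, show (e ∘ e.symm : ι → ι) = id from funext e.apply_symm_apply,
    Function.comp_id] at this

lemma Covers.surjective [Fintype ι] {ρ : ℕ} {h : ι → V} (hh : Covers K h ρ) :
    Function.Surjective (Fintype.linearCombination K h) := by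
  rw [← LinearMap.range_eq_top, Fintype.range_linearCombination, hh.span_eq_top]

end Transfer

/-! ### Codes and their parity-check columns -/

section Codes

variable {K : Type*} [Field K] [DecidableEq K] {V : Type*} [AddCommGroup V] [Module K V] {n : ℕ}

/-- The code with parity check columns `h i` has covering radius at most `ρ` if and only if every
syndrome is a combination of at most `ρ` columns. -/
lemma coversWithRadius_ker_iff {h : Fin n → V} {ρ : ℕ}
    (hs : Function.Surjective (Fintype.linearCombination K h)) :
    CoversWithRadius (LinearMap.ker (Fintype.linearCombination K h)) ρ ↔ Covers K h ρ := by
  constructor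
  · intro H v
    obtain ⟨x, rfl⟩ := hs v
    obtain ⟨c, hc, hd⟩ := H x
    have e : Fintype.linearCombination K h x = ∑ i, (x - c) i • h i := by
      rw [← Fintype.linearCombination_apply, map_sub, LinearMap.mem_ker.1 hc, sub_zero]
    rw [e]
    refine comb_le_of_sum _ _ (le_trans (le_of_eq ?_) hd)
    simp [hammingDist, sub_ne_zero]
  · intro H x
    obtain ⟨T, hT, c, hc, hsum⟩ := H (Fintype.linearCombination K h x)
    let y : Fin n → K := fun i => if i ∈ T then c i else 0
    have hy : Fintype.linearCombination K h y = Fintype.linearCombination K h x := by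
      rw [← hsum, Fintype.linearCombination_apply]
      simp [y, ite_smul]
    refine ⟨x - y, by simp [LinearMap.mem_ker, hy], le_trans (Finset.card_le_card ?_) hT⟩
    intro i hi
    by_contra hn
    simp [y, hn] at hi

lemma lengthFunction_le [Module.Finite K V] {ι : Type*} [Fintype ι] {h : ι → V} {R : ℕ}
    (hh : IsLeast {ρ | Covers K h ρ} R) :
    lengthFunction K (Module.finrank K V) R ≤ (Fintype.card ι : ℕ∞) := by
  let e := (Fintype.equivFin ι).symm
  have hs : Function.Surjective (Fintype.linearCombination K (h ∘ e)) :=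
    Covers.surjective (hh.1.reindex e)
  refine iInf₂_le _ ⟨LinearMap.ker (Fintype.linearCombination K (h ∘ e)), ?_, ?_⟩
  · have := LinearMap.finrank_range_add_finrank_ker (Fintype.linearCombination K (h ∘ e))
    rw [LinearMap.range_eq_top.2 hs, finrank_top, Module.finrank_fin_fun] at this
    rw [add_comm, this]
  · simpa only [coversWithRadius_ker_iff hs, covers_reindex_iff] using hh

lemma IsCoveringCode.exists_family {C : Submodule K (Fin n → K)} {r R : ℕ}
    (hC : IsCoveringCode C r R) :
    ∃ h : Fin n → (Fin n → K) ⧸ C, Module.finrank K ((Fin n → K) ⧸ C) = r ∧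
      IsLeast {ρ | Covers K h ρ} R := by
  let h : Fin n → (Fin n → K) ⧸ C := fun i => C.mkQ (Pi.single i 1)
  have e : Fintype.linearCombination K h = C.mkQ := by
    ext i
    simp [h, Fintype.linearCombination_apply_single]
  have hs : Function.Surjective (Fintype.linearCombination K h) := by
    rw [e]
    exact C.mkQ_surjective
  refine ⟨h, ?_, ?_⟩
  · have h1 := C.finrank_quotient_add_finrank
    have h2 := hC.1
    rw [Module.finrank_fin_fun] at h1
    omega
  · have := hC.2
    simpa only [← coversWithRadius_ker_iff hs, e, Submodule.ker_mkQ] using this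

end Codes

/-! ### Saturating sets and families of vectors -/

section Saturating

variable {K : Type*} [Field K] {N : ℕ} {ι : Type*} [Fintype ι]

open Classical in
/-- The set of points represented by the nonzero members of a family. -/
noncomputable def pointSet (h : ι → Fin (N + 1) → K) : Finset (PG N K) :=
  Finset.univ.image fun i : {i // h i ≠ 0} => Projectivization.mk K (h i) i.2

lemma card_pointSet_le (h : ι → Fin (N + 1) → K) : (pointSet h).card ≤ Fintype.card ι := by
  classical
  refine Finset.card_image_le.trans ?_
  rw [Finset.card_univ]
  exact Fintype.card_subtype_le _

lemma saturatesWith_pointSet_iff {h : ι → Fin (N + 1) → K} {ρ : ℕ} :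
    SaturatesWith (pointSet h) ρ ↔ Covers K h (ρ + 1) := by
  classical
  constructor
  · intro H v
    by_cases hv : v = 0
    · exact hv ▸ ⟨∅, by simp, CombOn.empty h⟩
    obtain ⟨T, hTS, hT, hle⟩ := H (Projectivization.mk K v hv)
    have hex : ∀ P : T, ∃ i, ∃ hi : h i ≠ 0, Projectivization.mk K (h i) hi = P := by
      intro P
      obtain ⟨i, -, hi⟩ := Finset.mem_image.1 (hTS P.2)
      exact ⟨i, i.2, hi⟩
    choose j hj0 hj using hex
    have hmem : v ∈ Submodule.span K (h '' (Finset.univ.image j : Finset ι)) := by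
      have hsup : (⨆ P ∈ T, P.submodule) ≤
          Submodule.span K (h '' (Finset.univ.image j : Finset ι)) := by
        refine iSup₂_le fun P hP => ?_
        have e : Projectivization.mk K (h (j ⟨P, hP⟩)) (hj0 _) = P := hj ⟨P, hP⟩
        rw [← e, Projectivization.submodule_mk, Submodule.span_singleton_le_iff_mem]
        exact Submodule.subset_span ⟨_, by simp, rfl⟩
      refine hsup (hle ?_)
      rw [Projectivization.submodule_mk]
      exact Submodule.mem_span_singleton_self v
    rw [Submodule.mem_span_image_finset_iff_exists_fun'] at hmem
    obtain ⟨c, rfl⟩ := hmem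
    refine comb_le_of_sum _ _ ((Finset.card_filter_le _ _).trans (Finset.card_image_le.trans ?_))
    simpa using hT
  · intro H A
    obtain ⟨T, hT, c, hc, hsum⟩ := H A.rep
    let f : {i // h i ≠ 0} → PG N K := fun i => Projectivization.mk K (h i) i.2
    refine ⟨(T.subtype (h · ≠ 0)).image f, Finset.image_subset_image (Finset.subset_univ _),
      Finset.card_image_le.trans ?_, ?_⟩
    · rw [Finset.card_subtype]
      exact (Finset.card_filter_le _ _).trans hT
    · rw [Projectivization.submodule_eq, Submodule.span_singleton_le_iff_mem, ← hsum]
      refine Submodule.sum_mem _ fun i hi => Submodule.smul_mem _ _ ?_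
      by_cases hi0 : h i = 0
      · rw [hi0]
        exact Submodule.zero_mem _
      · refine Submodule.mem_iSup_of_mem (f ⟨i, hi0⟩) (Submodule.mem_iSup_of_mem
          (Finset.mem_image_of_mem _ (by simpa using hi)) ?_)
        rw [Projectivization.submodule_mk]
        exact Submodule.mem_span_singleton_self _

lemma smallestSaturatingSize_le {V : Type*} [AddCommGroup V] [Module K V] [Module.Finite K V]
    {h : ι → V} {ρ : ℕ} (hV : Module.finrank K V = N + 1)
    (hh : IsLeast {ρ | Covers K h ρ} (ρ + 1)) :
    smallestSaturatingSize K N ρ ≤ (Fintype.card ι : ℕ∞) := by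
  let e : V ≃ₗ[K] (Fin (N + 1) → K) := LinearEquiv.ofFinrankEq _ _ (by simpa using hV)
  refine (iInf₂_le (pointSet (e ∘ h)) ⟨?_, ?_⟩).trans (by exact_mod_cast card_pointSet_le _)
  · exact saturatesWith_pointSet_iff.2 (hh.1.map e)
  · intro σ hσ
    have := hh.2 ((covers_map_iff e).1 (saturatesWith_pointSet_iff.1 hσ))
    omega

lemma pointSet_rep (S : Finset (PG N K)) : pointSet (fun P : S => P.1.rep) = S := by
  classical
  ext P
  simp only [pointSet, Finset.mem_image, Finset.mem_univ, true_and]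
  constructor
  · rintro ⟨⟨Q, hQ⟩, rfl⟩
    rw [Projectivization.mk_rep]
    exact Q.2
  · intro hP
    exact ⟨⟨⟨P, hP⟩, P.rep_nonzero⟩, P.mk_rep⟩

lemma IsSaturating.isLeast_covers {S : Finset (PG N K)} {ρ : ℕ} (hS : IsSaturating S ρ) :
    IsLeast {σ | Covers K (fun P : S => P.1.rep) σ} (ρ + 1) := by
  have key : ∀ σ, Covers K (fun P : S => P.1.rep) (σ + 1) ↔ SaturatesWith S σ := fun σ => by
    rw [← saturatesWith_pointSet_iff, pointSet_rep]
  refine ⟨(key ρ).2 hS.1, ?_⟩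
  rintro (_ | σ) hσ
  -- Vector radius σ + 1 matches saturation σ, so radius 0 has no counterpart; it fails on the
  -- nonzero all-ones vector.
  · obtain ⟨T, hT, c, -, hsum⟩ := hσ (fun _ => 1)
    obtain rfl : T = ∅ := by simpa using hT
    simpa using congrFun hsum 0
  · exact Nat.succ_le_succ (hS.2 ((key σ).1 hσ))

end Saturating

/-! ### Bounds for the length function -/

section Bounds

variable {K : Type*} [Field K] [DecidableEq K]

lemma Covers.lengthFunction_le {ι V : Type*} [Fintype ι] [AddCommGroup V] [Module K V]
    [Module.Finite K V] {h : ι → V} {r R : ℕ} (hh : Covers K h R) (hV : Module.finrank K V = r)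
    (hR : R ≤ r) : lengthFunction K r R ≤ (Fintype.card ι : ℕ∞) := by
  subst hV
  obtain ⟨h', hh'⟩ := hh.exists_isLeast hR
  exact _root_.lengthFunction_le hh'

end Bounds

/-- The shortest codes of codimension `r` and covering radius `R` correspond to the smallest
`(R - 1)`-saturating sets of `PG(r - 1, K)`. -/
lemma lengthFunction_eq_smallestSaturatingSize (K : Type*) [Field K] [DecidableEq K] {r R : ℕ}
    (hr : 1 ≤ r) (hR : 1 ≤ R) :
    lengthFunction K r R = smallestSaturatingSize K (r - 1) (R - 1) := by
  obtain ⟨N, rfl⟩ : ∃ N, r = N + 1 := ⟨r - 1, by omega⟩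
  obtain ⟨ρ, rfl⟩ : ∃ ρ, R = ρ + 1 := ⟨R - 1, by omega⟩
  refine le_antisymm (le_iInf₂ fun S hS => ?_) (le_iInf₂ fun n hC => ?_)
  · have := lengthFunction_le hS.isLeast_covers
    simpa using this
  · obtain ⟨C, hC⟩ := hC
    obtain ⟨h, hr, hh⟩ := hC.exists_family
    simpa using smallestSaturatingSize_le hr hh

section Bounds

variable {K : Type*} [Field K] [Fintype K]

lemma exists_graphCertificate {q : ℕ} (hq : Fintype.card K = q) (h : q = 5 ∨ 7 ≤ q) :
    ∃ f : K → K, GraphCertificate K f := by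
  obtain rfl | rfl | h8 : q = 5 ∨ q = 7 ∨ 8 ≤ q := by omega
  · exact exists_graphCertificate_five hq
  · exact exists_graphCertificate_seven hq
  · exact exists_graphCertificate_of_eight_le (hq ▸ h8)

variable [DecidableEq K]

lemma PlaneGood.lengthFunction_le {rel : ℕ → ℕ → Prop} (hK : 4 ≤ Fintype.card K)
    (hrefl : ∀ n, rel n n) (hadd : ∀ a b c d, rel a b → rel c d → rel (a + c) (b + d))
    (hle : ∀ a b, rel a b → a ≤ b) {f : K → K} (hf : PlaneGood rel f) {R : ℕ} (hR : 3 ≤ R) :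
    lengthFunction K (2 * R) R ≤ ((R * Fintype.card K + 1 : ℕ) : ℕ∞) := by
  obtain ⟨V, _, _, _, J, _, g, P, hg, hV, hJ⟩ := exists_good hK hrefl hadd hf R (by omega)
  have hc : Covers K (consFam g P) R := by
    intro v
    refine (CombP.consFam (fun a b h => hadd a b 1 1 h (hrefl 1)) ?_).mono_rel hle
    by_cases hv : v = 0
    · rw [hv]
      exact hg.cover_zero hR
    · exact hg.cover v hv
  have := hc.lengthFunction_le hV (by omega)
  rwa [Fintype.card_option, hJ] at this

lemma GraphCertificate.lengthFunction_le (hK : 4 ≤ Fintype.card K) {f : K → K}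
    (hf : GraphCertificate K f) {t R : ℕ} (hR : 3 ≤ R) (ht : 3 ≤ t)
    (hRt : R ≤ Fintype.card K ^ (t - 3)) :
    lengthFunction K (t * R) R ≤
      (((R * Fintype.card K + 1) * Fintype.card K ^ (t - 2) : ℕ) : ℕ∞) := by
  obtain ⟨m, rfl⟩ : ∃ m, t = m + 3 := ⟨t - 3, by omega⟩
  obtain ⟨V, _, _, _, J, _, g, P, hg, hV, hJ⟩ := exists_good hK (fun _ => rfl)
    (fun _ _ _ _ h h' => by rw [h, h']) (hf.planeGood (rel := Eq) fun _ => rfl) R (by omega)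
  have hc : ∀ v, Comb K Eq (consFam g P) R v := by
    intro v
    refine CombP.consFam (fun a b h => by rw [h]) ?_
    by_cases hv : v = 0
    · rw [hv]
      exact hg.cover_zero hR
    · exact hg.cover v hv
  -- Here t = m + 3, so the extension has degree t - 2 and the Rq + 1 columns must fit on a
  -- projective line with q^(m+1) + 1 points.
  obtain ⟨E, _, _, _, h', _, hh', hE, hV'⟩ := exists_comb_lift hc (m + 1) (by omega) (by
    rw [Fintype.card_option, hJ, pow_succ]
    exact Nat.succ_le_succ (Nat.mul_le_mul_right _ hRt))
  have hcov : Covers K h' R := fun v => (hh' v).mono_rel fun a b h => h.le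
  have := hcov.lengthFunction_le (r := (m + 3) * R) (by rw [hV', hV]; ring) (by nlinarith)
  rwa [Fintype.card_prod, Fintype.card_option, hJ, hE] at this

lemma lengthFunction_le_lengthBound {q t R : ℕ} (hq : Fintype.card K = q) (h7 : 7 ≤ q)
    (hR : 3 ≤ R) (ht : t = 2 ∨ 3 ≤ t ∧ R ≤ q ^ (t - 3)) (Δ : ℕ) :
    lengthFunction K (t * R) R ≤ (lengthBound q t R Δ : ℕ∞) := by
  obtain ⟨f, hf⟩ := exists_graphCertificate hq (.inr h7)
  subst hq
  rcases ht with rfl | ⟨ht, hRt⟩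
  · refine ((hf.planeGood (rel := Eq) fun _ => rfl).lengthFunction_le (by omega) (fun _ => rfl)
      (fun _ _ _ _ h h' => by rw [h, h']) (fun _ _ h => h.le) hR).trans ?_
    exact_mod_cast by simp [lengthBound]
  · refine (hf.lengthFunction_le (by omega) hR ht hRt).trans ?_
    obtain ⟨m, rfl⟩ : ∃ m, t = m + 3 := ⟨t - 3, by omega⟩
    have h : (R * Fintype.card K + 1) * Fintype.card K ^ (m + 3 - 2) ≤
        lengthBound (Fintype.card K) (m + 3) R Δ := by
      have e : lengthBound (Fintype.card K) (m + 3) R Δ =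
          (R * Fintype.card K + 1) * Fintype.card K ^ (m + 1) + Δ := by
        simp only [lengthBound, show m + 3 - 1 = m + 2 by omega, show m + 3 - 2 = m + 1 by omega]
        ring
      rw [e]
      exact Nat.le_add_right _ _
    exact_mod_cast h

lemma le_pow_of_ceil_logb_le {q a n : ℕ} (hq : 2 ≤ q) (ha : 0 < a)
    (h : ⌈Real.logb (q : ℝ) (a : ℝ)⌉₊ ≤ n) : a ≤ q ^ n := by
  have h1 : Real.logb (q : ℝ) (a : ℝ) ≤ n := Nat.ceil_le.1 h
  rw [Real.logb_le_iff_le_rpow (by exact_mod_cast hq) (by exact_mod_cast ha),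
    Real.rpow_natCast] at h1
  exact_mod_cast h1

end Bounds

theorem mainTheorem8 {K : Type*} [Field K] [Fintype K] [DecidableEq K] (q : ℕ)
    (hq : Fintype.card K = q) (t R : ℕ) (ht : 2 ≤ t) (hR : 4 ≤ R) :
    lengthFunction K (t * R) R = smallestSaturatingSize K (t * R - 1) (R - 1) ∧
    (t = 2 → (q = 4 ∨ 7 ≤ q) →
      lengthFunction K (t * R) R ≤ (lengthBound q t R 0 : ℕ∞)) ∧
    (t = 2 → q = 5 → (R = 4 ∨ R = 5) →
      lengthFunction K (t * R) R ≤ (lengthBound q t R 0 : ℕ∞)) ∧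
    (⌈Real.logb (q : ℝ) (R : ℝ)⌉₊ + 3 ≤ t → 7 ≤ q → Odd q →
      lengthFunction K (t * R) R ≤ (lengthBound q t R 0 : ℕ∞)) ∧
    (mOne q R + 2 < t → t < 3 * mOne q R + 2 → 8 ≤ q → Even q →
      lengthFunction K (t * R) R ≤
        (lengthBound q t R (∑ j ∈ Finset.Icc 2 t, q ^ (t - j)) : ℕ∞)) ∧
    ((t = mOne q R + 2 ∨ 3 * mOne q R + 2 ≤ t) → 8 ≤ q → Even q →
      lengthFunction K (t * R) R ≤
        (lengthBound q t R (∑ j ∈ Finset.Icc 2 (mOne q R + 2), q ^ (t - j)) : ℕ∞)) := by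
  have hR3 : 3 ≤ R := by omega
  -- As m₁ + 2 = ⌈log_q (R + 1)⌉ + 3, the ranges of t in (iv) and (v) all allow the lift.
  have hm : 7 ≤ q → mOne q R + 2 ≤ t → 3 ≤ t ∧ R ≤ q ^ (t - 3) := by
    intro h7 h
    rw [mOne] at h
    refine ⟨by omega, (Nat.le_succ R).trans (le_pow_of_ceil_logb_le (by omega) (by omega) ?_)⟩
    push_cast
    omega
  refine ⟨lengthFunction_eq_smallestSaturatingSize K (by nlinarith) (by omega), ?_, ?_, ?_, ?_, ?_⟩
  · rintro rfl (rfl | h7)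
    · refine ((planeGood_sq_of_card_eq_four hq).lengthFunction_le hq.ge (fun _ => le_rfl)
        (fun _ _ _ _ h h' => Nat.add_le_add h h') (fun _ _ h => h) hR3).trans ?_
      rw [hq]
      exact_mod_cast by simp [lengthBound]
    · exact lengthFunction_le_lengthBound hq h7 hR3 (.inl rfl) 0
  · rintro rfl rfl -
    obtain ⟨f, hf⟩ := exists_graphCertificate hq (.inl rfl)
    refine ((hf.planeGood (rel := Eq) fun _ => rfl).lengthFunction_le (by omega) (fun _ => rfl)
      (fun _ _ _ _ h h' => by rw [h, h']) (fun _ _ h => h.le) hR3).trans ?_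
    rw [hq]
    exact_mod_cast by simp [lengthBound]
  · intro h h7 _
    exact lengthFunction_le_lengthBound hq h7 hR3 (.inr ⟨by omega,
      le_pow_of_ceil_logb_le (by omega) (by omega) (by omega)⟩) 0
  · intro h _ h8 _
    exact lengthFunction_le_lengthBound hq (by omega) hR3 (.inr (hm (by omega) (by omega))) _
  · intro h h8 _
    exact lengthFunction_le_lengthBound hq (by omega) hR3 (.inr (hm (by omega) (by omega))) _
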